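/- Let $\mathbb{BC}=\{Z=z_1+jz_2:\ z_\ell=x_\ell+iy_\ell\in\mathbb C\}$ be the commutative algebra of bicomplex numbers ($i^2=j^2=-1$, $ij=ji$), with $|Z|^2=|z_1|^2+|z_2|^2$, $Z^*=\bar z_1-j\bar z_2$, $Z^\dagger=z_1-jz_2$ and idempotents $e_\pm=\frac{1\pm ij}{2}$, so that $Z=Z^+e_++Z^-e_-$ with $Z^\pm=z_1\mp iz_2$; put $e^{Z}=e^{Z^+}e_++e^{Z^-}e_-$. Let $\sigma>0$ and let $\nu,\mu\in\mathbb{BC}$ satisfy $\nu^2=\mu^2=-1$. Let $L^2_{\mathbb{BC}}(\mathbb R)$ and $L^2_{\mathbb{BC}}(\mathbb{BC})$ be the spaces of square integrable $\mathbb{BC}$-valued functions for $dt$ and for $d\lambda(Z)=\frac14\,dx_1dy_1dx_2dy_2$ respectively, with norm $\|f\|^2=\int|f|^2$ and bicomplex scalar product $\langle f,g\rangle=\int f g^*$. For $Z\in\mathbb{BC}$ put $X_e=x_1e_++x_2e_-$, $Y_e=y_1e_++y_2e_-$, $z_{1_\nu}=x_1+\nu y_1$, $z_{2_\mu}=x_2+\mu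 y_2$ and $Z^e=z_{1_\nu}e_++z_{2_\mu}e_-$. The unidimensional bicomplex Fourier--Wigner transform of $\varphi,\psi\in L^2_{\mathbb{BC}}(\mathbb R)$ is $$\mathcal V(\varphi,\psi)(Z)=\frac{\sigma}{\pi}\,e^{-\frac\sigma4\left((X_e^\dagger)^2+(Y_e^\dagger)^2\right)}\int_{\mathbb R}\varphi(t)\,e^{\sigma(\nu e_++\mu e_-)\left(t-\frac{X_e}{2}\right)Y_e}\left(\psi^+(t-x_1)e_++\psi^-(t-x_2)e_-\right)^*dt .$$ A function $f:\mathbb{BC}\to\mathbb{BC}$ is called $\mathbb{BC}^e$-holomorphic if $f(Z)=f^e(Z^e)$ with $f^e$ real differentiable and $$\left(\partial_{\bar z_{2_\mu}}e_++\partial_{\bar z_{1_\nu}}e_-\right)f^e=\left(\partial_{\bar z_{1_\nu}}e_++\partial_{\bar z_{2_\mu}}e_-\right)f^e=\left(\partial_{z_{2_\mu}}e_++\partial_{z_{1_\nu}}e_-\right)f^e=0,$$ where $\partial_{z_{1_\nu}}=\frac12(\partial_{x_1}-\nu\partial_{y_1})$, $\partial_{\bar z_{1_\nu}}=\frac12(\partial_{x_1}+\nu\partial_{y_1})$,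 and similarly for $z_{2_\mu}$ with $\mu$, $x_2$, $y_2$. Let $\mathcal M_0$ be the space of all functions $e^{-\frac\sigma2|Z^e|^2}f(Z)$ with $f$ $\mathbb{BC}^e$-holomorphic of the form $f(Z)=F(z_{1_\nu})e_++G(z_{2_\mu})e_-$, where $F,G$ are $\mathbb C$-valued functions on the planes $\{x+\nu y\}$ and $\{x+\mu y\}$ ($x,y\in\mathbb R$), square integrable for the weight $e^{-\frac\sigma2(x^2+y^2)}dx\,dy$. Then $\mathcal M_0$ is a Hilbert space, as a closed subspace of $L^2_{\mathbb{BC}}(\mathbb{BC})$, and the following holds. (i) With the window $\psi_0(t)=e^{-\frac\sigma2t^2}$, the transform $$\mathcal S_0\varphi=\left(\frac\sigma\pi\right)^{1/4}\mathcal V(\varphi,\psi_0)$$ is well defined on $L^2_{\mathbb{BC}}(\mathbb R)$ (the integral converges absolutely for every $Z$), is $\mathbb{BC}$-linear, maps $L^2_{\mathbb{BC}}(\mathbb R)$ onto $\mathcal M_0$, and is an isometry: $\|\mathcal S_0\varphi\|=\|\varphi\|$ and $\langle\mathcal S_0\varphi_1,\mathcal S_0\varphi_2\rangle=\langle\varphi_1,\varphi_2\rangle$.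 (ii) The functions $$\varphi_n(Z)=\left(\frac\sigma\pi\right)^{3/4}\sigma^n\,(Z^e)^n\,e^{-\frac\sigma2|Z^e|^2},\qquad n=0,1,2,\dots,$$ form an orthogonal basis of $\mathcal M_0$: they belong to $\mathcal M_0$, $\langle\varphi_m,\varphi_n\rangle=0$ for $m\neq n$, and every $\Upsilon\in\mathcal M_0$ has a unique expansion $\Upsilon=\sum_{n\ge0}c_n\varphi_n$, $c_n\in\mathbb{BC}$, convergent in $L^2_{\mathbb{BC}}(\mathbb{BC})$. Moreover $$\|\varphi_n\|^2_{L^2_{\mathbb{BC}}(\mathbb{BC})}=\left(\frac\pi\sigma\right)^{1/2}2^n\sigma^n\,n!\,.$$ -/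

import Mathlib

open MeasureTheory Filter Topology
open scoped ENNReal

namespace BicomplexFW

noncomputable section

/-! ## Bicomplex numbers -/

/-- The commutative algebra of bicomplex numbers `z₁ + j z₂` with `z₁ z₂ : ℂ` and `j ^ 2 = -1`.
`Z.re` is `z₁` and `Z.im` is `z₂`. -/
abbrev Bicomplex : Type := QuadraticAlgebra ℂ (-1) 0

/-- The pair `(z₁, z₂)` in the Hermitian space `ℂ²`. -/
def toL2 : Bicomplex →ₗ[ℝ] WithLp 2 (ℂ × ℂ) where
  toFun Z := WithLp.toLp 2 (Z.re, Z.im)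
  map_add' _ _ := rfl
  map_smul' _ _ := rfl

theorem toL2_injective : Function.Injective toL2 := by
  intro Z W h
  have h' : (Z.re, Z.im) = (W.re, W.im) := congrArg WithLp.ofLp h
  exact QuadraticAlgebra.ext (congrArg Prod.fst h') (congrArg Prod.snd h')

/-- The Euclidean norm `‖z₁ + j z₂‖ = (|z₁|² + |z₂|²)^{1/2}`. -/
instance : NormedAddCommGroup Bicomplex :=
  NormedAddCommGroup.induced Bicomplex (WithLp 2 (ℂ × ℂ)) toL2 toL2_injective

instance : NormedSpace ℝ Bicomplex :=
  NormedSpace.induced ℝ Bicomplex (WithLp 2 (ℂ × ℂ)) toL2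

theorem norm_sq_eq (Z : Bicomplex) : ‖Z‖ ^ 2 = ‖Z.re‖ ^ 2 + ‖Z.im‖ ^ 2 :=
  WithLp.prod_norm_sq_eq_of_L2 (toL2 Z)

instance : FiniteDimensional ℝ Bicomplex :=
  FiniteDimensional.of_injective toL2 toL2_injective

instance : CompleteSpace Bicomplex := FiniteDimensional.complete ℝ Bicomplex

instance : MeasurableSpace Bicomplex := borel Bicomplex

instance : BorelSpace Bicomplex := ⟨rfl⟩

/-- The idempotent `e₊ = (1 + i j) / 2`. -/
def ePlus : Bicomplex := ⟨1 / 2, Complex.I / 2⟩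

/-- The idempotent `e₋ = (1 - i j) / 2`. -/
def eMinus : Bicomplex := ⟨1 / 2, -Complex.I / 2⟩

/-- The embedding of the real numbers. -/
def ofR (t : ℝ) : Bicomplex := ⟨(t : ℂ), 0⟩

/-- The embedding of `ℂ` (the complex numbers `x + i y`). -/
def ofC (z : ℂ) : Bicomplex := ⟨z, 0⟩

/-- The component `Z⁺` in `Z = Z⁺ e₊ + Z⁻ e₋`. -/
def plusC (Z : Bicomplex) : ℂ := Z.re - Complex.I * Z.im

/-- The component `Z⁻` in `Z = Z⁺ e₊ + Z⁻ e₋`. -/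
def minusC (Z : Bicomplex) : ℂ := Z.re + Complex.I * Z.im

theorem idempotent_decomposition (Z : Bicomplex) :
    Z = ofC (plusC Z) * ePlus + ofC (minusC Z) * eMinus := by
  have hI : Complex.I * Complex.I = -1 := Complex.I_mul_I
  ext
  · simp [ofC, plusC, minusC, ePlus, eMinus]
    ring
  · simp [ofC, plusC, minusC, ePlus, eMinus]
    linear_combination Z.im * hI

/-- The conjugate `Z* = \bar z₁ - j \bar z₂`. -/
def conjStar (Z : Bicomplex) : Bicomplex :=
  ⟨(starRingEnd ℂ) Z.re, -(starRingEnd ℂ) Z.im⟩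

/-- The conjugate `Z† = z₁ - j z₂`. -/
def conjDagger (Z : Bicomplex) : Bicomplex := ⟨Z.re, -Z.im⟩

/-- The bicomplex exponential, `e^Z = e^{Z⁺} e₊ + e^{Z⁻} e₋`. -/
def bexp (Z : Bicomplex) : Bicomplex :=
  ofC (Complex.exp (plusC Z)) * ePlus + ofC (Complex.exp (minusC Z)) * eMinus

/-- Integration over the bicomplex numbers: the measure
`dλ(Z) = (1/4) dx₁ dy₁ dx₂ dy₂` for `Z = (x₁ + i y₁) + j (x₂ + i y₂)`. As
`x₁ + ν y₁` and `x₂ + μ y₂` are the idempotent components of the companion of `Z`, it is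
Lebesgue measure in the variable `companion ν μ Z`. -/
def bcMeasure : Measure Bicomplex :=
  (4 : ℝ≥0∞)⁻¹ • Measure.map (fun p : ℂ × ℂ => (⟨p.1, p.2⟩ : Bicomplex)) volume

/-- The bicomplex scalar product `∫ f g* dm` on `L²(m)`. -/
def bcInner {α : Type} [MeasurableSpace α] (m : Measure α) (f g : α → Bicomplex) : Bicomplex :=
  ∫ a, f a * conjStar (g a) ∂m

/-! ## The bicomplex Fourier--Wigner transform -/

/-- The hyperbolic number `X_e = x₁ e₊ + x₂ e₋`. -/
def hypX (Z : Bicomplex) : Bicomplex := ofR Z.re.re * ePlus + ofR Z.im.re * eMinus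

/-- The hyperbolic number `Y_e = y₁ e₊ + y₂ e₋`. -/
def hypY (Z : Bicomplex) : Bicomplex := ofR Z.re.im * ePlus + ofR Z.im.im * eMinus

/-- The translation `T_{X_e} φ (t) = φ⁺(t - x₁) e₊ + φ⁻(t - x₂) e₋`. -/
def translation (Z : Bicomplex) (φ : ℝ → Bicomplex) (t : ℝ) : Bicomplex :=
  ofC (plusC (φ (t - Z.re.re))) * ePlus + ofC (minusC (φ (t - Z.im.re))) * eMinus

/-- The modulation `e^{σ (ν e₊ + μ e₋) (t - X_e / 2) Y_e} φ(t)`. -/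
def modulation (σ : ℝ) (ν μ : Bicomplex) (Z : Bicomplex) (φ : ℝ → Bicomplex) (t : ℝ) :
    Bicomplex :=
  bexp (ofR σ * (ν * ePlus + μ * eMinus) * (ofR t - ofR (1 / 2) * hypX Z) * hypY Z) * φ t

/-- The integrand of the unidimensional bicomplex Fourier--Wigner transform. -/
def fwIntegrand (σ : ℝ) (ν μ : Bicomplex) (φ ψ : ℝ → Bicomplex) (Z : Bicomplex) (t : ℝ) :
    Bicomplex :=
  φ t * modulation σ ν μ Z (fun s => conjStar (translation Z ψ s)) t

/-- The unidimensional bicomplex Fourier--Wigner transform. -/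
def fwTransform (σ : ℝ) (ν μ : Bicomplex) (φ ψ : ℝ → Bicomplex) (Z : Bicomplex) : Bicomplex :=
  ofR (σ / Real.pi) *
    bexp (ofR (-(σ / 4)) * (conjDagger (hypX Z) ^ 2 + conjDagger (hypY Z) ^ 2)) *
      ∫ t : ℝ, fwIntegrand σ ν μ φ ψ Z t

/-- The Gaussian window `ψ₀(t) = e^{-σ t² / 2}`. -/
def gaussWindow (σ : ℝ) (t : ℝ) : Bicomplex := ofR (Real.exp (-(σ / 2) * t ^ 2))

/-- The transform `S₀ φ = (σ / π)^{1/4} V(φ, ψ₀)`. -/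
def S0 (σ : ℝ) (ν μ : Bicomplex) (φ : ℝ → Bicomplex) (Z : Bicomplex) : Bicomplex :=
  ofR ((σ / Real.pi) ^ (1 / 4 : ℝ)) * fwTransform σ ν μ φ (gaussWindow σ) Z

/-! ## The companion Bargmann space -/

/-- `x₁ + ν y₁` for `Z = (x₁ + i y₁) + j (x₂ + i y₂)`. -/
def zNu (ν Z : Bicomplex) : Bicomplex := ofR Z.re.re + ν * ofR Z.re.im

/-- `x₂ + μ y₂` for `Z = (x₁ + i y₁) + j (x₂ + i y₂)`. -/
def zMu (μ Z : Bicomplex) : Bicomplex := ofR Z.im.re + μ * ofR Z.im.im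

/-- The companion `Z^e = (x₁ + ν y₁) e₊ + (x₂ + μ y₂) e₋` of `Z`. -/
def companion (ν μ Z : Bicomplex) : Bicomplex := zNu ν Z * ePlus + zMu μ Z * eMinus

/-- `∂/∂z = (∂_x - τ ∂_y) / 2` in the variable `z = x + τ y` of the component on the
idempotent `e` (that is, at points `W = z e + ⋯`). -/
def dHol (τ e : Bicomplex) (g : Bicomplex → Bicomplex) (W : Bicomplex) : Bicomplex :=
  ofR (1 / 2) * (fderiv ℝ g W e - τ * fderiv ℝ g W (τ * e))

/-- `∂/∂\bar z = (∂_x + τ ∂_y) / 2` in the variable `z = x + τ y` of the component on the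
idempotent `e`. -/
def dBar (τ e : Bicomplex) (g : Bicomplex → Bicomplex) (W : Bicomplex) : Bicomplex :=
  ofR (1 / 2) * (fderiv ℝ g W e + τ * fderiv ℝ g W (τ * e))

/-- A function `g` of the companion variable is holomorphic: it is real differentiable and its
derivatives with respect to `(Z^e)*`, `\bar{Z^e}` and `(Z^e)†` vanish. -/
def IsHolo (ν μ : Bicomplex) (g : Bicomplex → Bicomplex) : Prop :=
  Differentiable ℝ g ∧
  ∀ W, dBar μ eMinus g W * ePlus + dBar ν ePlus g W * eMinus = 0 ∧
    dBar ν ePlus g W * ePlus + dBar μ eMinus g W * eMinus = 0 ∧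
    dHol μ eMinus g W * ePlus + dHol ν ePlus g W * eMinus = 0

/-- `f` is holomorphic in the companion variable: `f(Z) = f^e(Z^e)` with `f^e` holomorphic. -/
def IsCompanionHolo (ν μ : Bicomplex) (f : Bicomplex → Bicomplex) : Prop :=
  ∃ fe : Bicomplex → Bicomplex, (∀ Z, f Z = fe (companion ν μ Z)) ∧ IsHolo ν μ fe

/-- `F` is square integrable on the plane `{x + τ y}` for the measure
`e^{-α (x² + y²)} dx dy`. Only the values of `F` on that plane matter. -/
def MemWeightedL2 (α : ℝ) (τ : Bicomplex) (F : Bicomplex → ℂ) : Prop :=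
  MemLp (fun p : ℝ × ℝ => F (ofR p.1 + τ * ofR p.2)) 2
    (volume.withDensity fun p : ℝ × ℝ => ENNReal.ofReal (Real.exp (-α * (p.1 ^ 2 + p.2 ^ 2))))

/-- The companion Bargmann space. -/
def companionBargmann (σ : ℝ) (ν μ : Bicomplex) : Set (Bicomplex → Bicomplex) :=
  {f | IsCompanionHolo ν μ f ∧ ∃ F G : Bicomplex → ℂ,
    (∀ Z, f Z = ofC (F (zNu ν Z)) * ePlus + ofC (G (zMu μ Z)) * eMinus) ∧
    MemWeightedL2 (σ / 2) ν F ∧ MemWeightedL2 (σ / 2) μ G}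

/-- The Gaussian-weighted space `M₀`: the functions `e^{-σ |Z^e|² / 2} f(Z)` with `f` in the
companion Bargmann space. -/
def M0 (σ : ℝ) (ν μ : Bicomplex) : Set (Bicomplex → Bicomplex) :=
  {U | ∃ f ∈ companionBargmann σ ν μ,
    ∀ Z, U Z = ofR (Real.exp (-(σ / 2) * ‖companion ν μ Z‖ ^ 2)) * f Z}

/-- The functions `(σ / π)^{3/4} σ^n (Z^e)^n e^{-σ |Z^e|² / 2}`. -/
def basisFun (σ : ℝ) (ν μ : Bicomplex) (n : ℕ) (Z : Bicomplex) : Bicomplex :=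
  ofR ((σ / Real.pi) ^ (3 / 4 : ℝ) * σ ^ n) * companion ν μ Z ^ n *
    ofR (Real.exp (-(σ / 2) * ‖companion ν μ Z‖ ^ 2))

end

end BicomplexFW

/-! ### Plancherel's theorem on the real line -/

namespace SegalBargmann

/-! In the idempotent basis the theorem splits into two copies of the classical Segal--Bargmann
theorem. A bicomplex square root of `-1` has components `±i`, so the components `p`, `q` of `Z^e`
are `z₁`, `z₂` up to conjugation, and `Z ↦ (p, q)` carries `dλ` to a quarter of Lebesgue measure on
`ℂ²`. Since `|Z^e|² = (|p|² + |q|²) / 2`, the weight `e^{-σ|Z^e|²/2}` is `g(p) g(q)` with `g(z) =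
e^{-σ|z|²/4}`. Hence `M₀` consists exactly of the functions `F(p)g(p)g(q) e₊ + G(q)g(q)g(p) e₋` with
`F`, `G` entire and square integrable for `g²` (`mem_M0_iff`). The Gaussian in the other variable
contributes only the constant `∫ g² = 2π/σ`.

The transform `S₀` has this same shape: `F` and `G` are a fixed multiple of the Segal--Bargmann
transforms of `φ⁺` and `φ⁻`, while the dagger in the prefactor exchanges components and so supplies
the Gaussian in the other variable (`S0_eq_separated`).

For the classical transform, multiplication by `g` turns it, up to a phase, into a Fourier transform
with a sliding Gaussian window; Plancherel in `y` and Tonelli in `x` give the norm identity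
(`lintegral_enorm_segal_sq`). The rest follows from `reproducing_formula`, which is a translation
combined with the mean value property of entire functions. By it, an entire function orthogonal to
all exponentials vanishes; exponentials are transforms of Gaussians, so the isometry is onto
(`exists_segal_eq`). Expanding the exponentials in power series shows that monomials are complete,
and rotation invariance makes them orthogonal (`existsUnique_monomial_expansion`). Finally `M₀` is
closed as the isometric image of a complete space. -/

theorem eLpNorm_two_sq {α E : Type*} [MeasurableSpace α] [NormedAddCommGroup E] (f : α → E)
    (μ : Measure α) : eLpNorm f 2 μ ^ 2 = ∫⁻ x, ‖f x‖ₑ ^ 2 ∂μ := by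
  have h := eLpNorm_nnreal_pow_eq_lintegral (f := f) (μ := μ) (p := 2) (by norm_num)
  simpa using h

open FourierTransform SchwartzMap in
/-- On integrable functions the `L²` Fourier transform is given by the Fourier integral. -/
theorem coeFn_fourier_toLp_ae {f : ℝ → ℂ} (hf : Integrable f) (hf2 : MemLp f 2) :
    ((𝓕 (hf2.toLp f) : Lp ℂ 2 (volume : Measure ℝ)) : ℝ → ℂ) =ᵐ[volume] 𝓕 f := by
  have hcont : Continuous (𝓕 f) :=
    VectorFourier.fourierIntegral_continuous Real.continuous_fourierChar
      (by fun_prop) hf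
  have hloc : LocallyIntegrable
      ((𝓕 (hf2.toLp f) : Lp ℂ 2 (volume : Measure ℝ)) : ℝ → ℂ) volume :=
    (Lp.memLp _).locallyIntegrable (by norm_num)
  refine ae_eq_of_integral_contDiff_smul_eq hloc hcont.locallyIntegrable ?_
  intro g hg hgc
  have hg₁ : HasCompactSupport (Complex.ofRealCLM ∘ g) := hgc.comp_left rfl
  have hg₂ : ContDiff ℝ ((⊤ : ℕ∞) : WithTop ℕ∞) (Complex.ofRealCLM ∘ g) := by fun_prop
  set G : 𝓢(ℝ, ℂ) := hg₁.toSchwartzMap hg₂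
  have hG : ∀ x, G x = (g x : ℂ) := fun x => rfl
  -- Both Fourier transforms can be moved onto the test function `G`: the `L²` one by the definition
  -- for tempered distributions, the integral one by Fubini.
  have h1 := congrArg (fun T => T G) (Lp.fourier_toTemperedDistribution_eq (hf2.toLp f))
  simp only [TemperedDistribution.fourier_apply, Lp.toTemperedDistribution_apply] at h1
  have h2 : ∫ x, (𝓕 G) x • (hf2.toLp f) x = ∫ x, (𝓕 G) x • f x := by
    refine integral_congr_ae ?_
    filter_upwards [hf2.coeFn_toLp] with x hx
    rw [hx]
  have h3 : ∫ x, (𝓕 G) x • f x = ∫ x, G x • 𝓕 f x := by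
    rw [SchwartzMap.fourier_coe]
    simpa using! (VectorFourier.integral_fourierIntegral_smul_eq_flip (L := innerₗ ℝ)
      Real.continuous_fourierChar continuous_inner G.integrable hf)
  have h4 := h1.symm.trans (h2.trans h3)
  simpa [hG] using h4

open FourierTransform in
/-- Plancherel's theorem for square integrable integrable functions. -/
theorem lintegral_enorm_fourier_sq {f : ℝ → ℂ} (hf : Integrable f) (hf2 : MemLp f 2) :
    ∫⁻ y, ‖𝓕 f y‖ₑ ^ 2 = ∫⁻ t, ‖f t‖ₑ ^ 2 := by
  have key : eLpNorm (𝓕 f) 2 volume = eLpNorm f 2 volume := by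
    rw [← eLpNorm_congr_ae (coeFn_fourier_toLp_ae hf hf2), ← eLpNorm_congr_ae hf2.coeFn_toLp,
      ← Lp.enorm_def, ← Lp.enorm_def, ← ofReal_norm, ← ofReal_norm, Lp.norm_fourier_eq]
  rw [← eLpNorm_two_sq, ← eLpNorm_two_sq, key]

/-! ### The Segal--Bargmann transform as an entire function -/

theorem memLp_cexp_quadratic {b : ℂ} (hb : 0 < b.re) (c d : ℂ) :
    MemLp (fun x : ℝ => Complex.exp (-b * x ^ 2 + c * x + d)) 2 := by
  have hcont : Continuous fun x : ℝ => Complex.exp (-b * x ^ 2 + c * x + d) := by fun_prop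
  rw [memLp_two_iff_integrable_sq_norm hcont.aestronglyMeasurable]
  have h := (integrable_cexp_quadratic (b := 2 * b) (by simpa using hb) (2 * c) (2 * d)).norm
  refine h.congr (Eventually.of_forall fun x => ?_)
  simp only [← norm_pow, ← Complex.exp_nat_mul]
  congr 2
  push_cast
  ring

/-- The kernel `exp(σ t z - σ t² / 2 - σ z² / 4)` of the Segal--Bargmann transform. -/
noncomputable def segalKernel (σ : ℝ) (z : ℂ) (t : ℝ) : ℂ :=
  Complex.exp (-(σ / 2 : ℂ) * t ^ 2 + σ * z * t + -(σ / 4) * z ^ 2)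

/-- The (unnormalized) Segal--Bargmann transform. -/
noncomputable def segal (σ : ℝ) (φ : ℝ → ℂ) (z : ℂ) : ℂ := ∫ t, φ t * segalKernel σ z t

/-- The square root `exp(-σ |z|² / 4)` of the Gaussian weight. -/
noncomputable def gauss (σ : ℝ) (z : ℂ) : ℝ := Real.exp (-(σ / 4) * ‖z‖ ^ 2)

theorem continuous_gauss (σ : ℝ) : Continuous (gauss σ) := by
  unfold gauss; fun_prop

variable {σ : ℝ}

theorem memLp_segalKernel (hσ : 0 < σ) (z : ℂ) : MemLp (segalKernel σ z) 2 :=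
  memLp_cexp_quadratic (by simpa using hσ) _ _

theorem integrable_mul_segalKernel (hσ : 0 < σ) {φ : ℝ → ℂ} (hφ : MemLp φ 2) (z : ℂ) :
    Integrable fun t => φ t * segalKernel σ z t :=
  hφ.integrable_mul (memLp_segalKernel hσ z)

/-- Differentiation under the integral sign. The factor `exp(-σ z² / 4)` does not depend on `t` and
is split off, so that only `exp(σ t z)` has to be differentiated. -/
theorem differentiable_segal (hσ : 0 < σ) {φ : ℝ → ℂ} (hφ : MemLp φ 2) :
    Differentiable ℂ (segal σ φ) := by
  set k : ℂ → ℝ → ℂ := fun z t => Complex.exp (-(σ / 2 : ℂ) * t ^ 2 + σ * z * t + 0) with hk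
  have hkm : ∀ z, MemLp (k z) 2 := fun z => memLp_cexp_quadratic (by simpa using hσ) _ _
  have hform : segal σ φ = fun z => (∫ t, φ t * k z t) * Complex.exp (-(σ / 4) * z ^ 2) := by
    funext z
    rw [segal, ← integral_mul_const]
    refine integral_congr_ae (Eventually.of_forall fun t => ?_)
    simp only [segalKernel, hk, mul_assoc, ← Complex.exp_add, add_zero]
  have hmain : Differentiable ℂ fun z => ∫ t, φ t * k z t := by
    intro z₀
    -- One unit covers the ball around `z₀`; the other absorbs the factor `σ|t| ≤ exp(σ|t|)`
    -- produced by the derivative. The sum of the kernels at the real points `R` and `-R` then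
    -- dominates for both signs of `t`.
    set R : ℝ := ‖z₀‖ + 2 with hR
    have hbd : Integrable fun t : ℝ => ‖φ t * k R t‖ + ‖φ t * k (-R : ℝ) t‖ :=
      (hφ.integrable_mul (hkm R)).norm.add (hφ.integrable_mul (hkm (-R : ℝ))).norm
    have hkc : ∀ z, Continuous (k z) := fun z => by simp only [hk]; fun_prop
    refine (hasDerivAt_integral_of_dominated_loc_of_deriv_le
      (F' := fun z t => φ t * (k z t * (σ * t)))
      (s := Metric.ball z₀ 1) (Metric.ball_mem_nhds _ one_pos) (Eventually.of_forall fun z => ?_)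
      (hφ.integrable_mul (hkm z₀)) ?_ (Eventually.of_forall fun t z hz => ?_) hbd
      (Eventually.of_forall fun t z hz => ?_)).2.differentiableAt
    · exact hφ.1.mul (hkc z).aestronglyMeasurable
    · exact hφ.1.mul ((hkc z₀).mul (by fun_prop)).aestronglyMeasurable
    · have hz' : ‖z‖ ≤ ‖z₀‖ + 1 := by
        have := norm_sub_norm_le z z₀
        rw [Metric.mem_ball, dist_eq_norm] at hz
        linarith
      have hre : ∀ w : ℂ, ‖k w t‖ = Real.exp (-(σ / 2) * t ^ 2 + σ * w.re * t) := fun w => by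
        simp only [hk, Complex.norm_exp]
        congr 1
        rw [show (-(σ / 2 : ℂ) * t ^ 2 + σ * w * t + 0) =
          ((-(σ / 2) * t ^ 2 : ℝ) : ℂ) + (σ * t : ℝ) * w by push_cast; ring]
        rw [Complex.add_re, Complex.ofReal_re, Complex.re_ofReal_mul]
        ring
      rw [norm_mul, norm_mul, norm_mul, norm_mul, norm_mul, ← mul_add]
      refine mul_le_mul_of_nonneg_left ?_ (norm_nonneg _)
      rw [hre, hre, hre, Complex.norm_real, Complex.norm_real, Complex.ofReal_re,
        Complex.ofReal_re, Real.norm_eq_abs, Real.norm_eq_abs, abs_of_pos hσ]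
      have h1 : σ * |t| ≤ Real.exp (σ * |t|) := (Real.add_one_le_exp _).trans' (by linarith)
      have h2 : σ * z.re * t ≤ σ * |t| * (‖z₀‖ + 1) := by
        have : z.re * t ≤ (‖z₀‖ + 1) * |t| :=
          (le_abs_self _).trans (by
            rw [abs_mul]
            exact mul_le_mul_of_nonneg_right ((Complex.abs_re_le_norm z).trans hz') (abs_nonneg _))
        nlinarith
      calc Real.exp (-(σ / 2) * t ^ 2 + σ * z.re * t) * (σ * |t|)
          ≤ Real.exp (-(σ / 2) * t ^ 2 + σ * |t| * (‖z₀‖ + 1)) * Real.exp (σ * |t|) := by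
            gcongr
        _ = Real.exp (-(σ / 2) * t ^ 2 + σ * R * |t|) := by
            rw [← Real.exp_add, hR]; congr 1; ring
        _ ≤ _ := by
            rcases abs_cases t with ⟨h, -⟩ | ⟨h, -⟩ <;> rw [h]
            · exact le_add_of_nonneg_right (Real.exp_pos _).le
            · refine (le_of_eq ?_).trans (le_add_of_nonneg_left (Real.exp_pos _).le)
              congr 1; ring
    · have h : HasDerivAt (fun w : ℂ => -(σ / 2 : ℂ) * t ^ 2 + σ * w * t + 0)
          ((σ : ℂ) * t) z := by
        simpa using (((hasDerivAt_id z).const_mul (σ : ℂ)).mul_const (t : ℂ)).const_add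
          (-(σ / 2 : ℂ) * t ^ 2) |>.add_const 0
      exact h.cexp.const_mul (φ t)
  rw [hform]
  exact hmain.mul (by fun_prop)

/-! ### The norm identity -/

/-- Completing the square: the weighted kernel is a time-frequency shift of a Gaussian, with centre
`x` and frequency proportional to `y`, up to a phase independent of `t`. -/
theorem segalKernel_mul_gauss (σ x y t : ℝ) :
    segalKernel σ (x + y * Complex.I) t * gauss σ (x + y * Complex.I) =
      Complex.exp ((-(σ * x * y / 2) : ℝ) * Complex.I) *
        (Complex.exp ((σ * t * y : ℝ) * Complex.I) * Real.exp (-(σ / 2) * (t - x) ^ 2)) := by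
  have h : ‖(x + y * Complex.I : ℂ)‖ ^ 2 = x ^ 2 + y ^ 2 := by
    rw [← Complex.normSq_eq_norm_sq, Complex.normSq_add_mul_I]
  simp only [segalKernel, gauss, h, Complex.ofReal_exp, ← Complex.exp_add]
  congr 1
  push_cast
  linear_combination (-(σ : ℂ) / 4 * y ^ 2) * Complex.I_sq

-- The phase has modulus one, so on each vertical line only a windowed Fourier transform remains.
-- The frequency `-σ y / (2π)` matches `e^{iσty}` with the convention `e^{-2πitξ}`.
open FourierTransform in
theorem enorm_segal_mul_gauss {φ : ℝ → ℂ} (x y : ℝ) :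
    ‖segal σ φ (x + y * Complex.I) * gauss σ (x + y * Complex.I)‖ₑ =
      ‖𝓕 (fun t : ℝ => φ t * Real.exp (-(σ / 2) * (t - x) ^ 2)) (-(σ / (2 * Real.pi)) * y)‖ₑ := by
  rw [segal, ← integral_mul_const, Real.fourier_eq']
  have h : ∀ t, φ t * segalKernel σ (x + y * Complex.I) t * gauss σ (x + y * Complex.I) =
      Complex.exp ((-(σ * x * y / 2) : ℝ) * Complex.I) *
      (Complex.exp (((-2 * Real.pi * inner ℝ t (-(σ / (2 * Real.pi)) * y) : ℝ) : ℂ) * Complex.I) •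
        (φ t * Real.exp (-(σ / 2) * (t - x) ^ 2))) := fun t => by
    rw [mul_assoc, segalKernel_mul_gauss]
    have : -2 * Real.pi * inner ℝ t (-(σ / (2 * Real.pi)) * y) = σ * t * y := by
      simp only [RCLike.inner_apply]
      simp
      field_simp
    rw [this, smul_eq_mul]
    ring
  simp_rw [h]
  rw [integral_const_mul, enorm_mul, ← ofReal_norm, Complex.norm_exp_ofReal_mul_I]
  simp

theorem lintegral_comp_mul_left_real (f : ℝ → ℝ≥0∞) {a : ℝ} (ha : a ≠ 0) :
    ∫⁻ y, f (a * y) = ENNReal.ofReal |a⁻¹| * ∫⁻ y, f y := by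
  have h := (Homeomorph.mulLeft₀ a ha).toMeasurableEquiv.measurableEmbedding.lintegral_map
    (μ := (volume : Measure ℝ)) f
  have h2 : Measure.map (Homeomorph.mulLeft₀ a ha).toMeasurableEquiv (volume : Measure ℝ)
    = ENNReal.ofReal |a⁻¹| • volume := Real.map_volume_mul_left ha
  rw [h2, lintegral_smul_measure] at h
  exact h.symm

theorem lintegral_complex (f : ℂ → ℝ≥0∞) (hf : Measurable f) :
    ∫⁻ z, f z = ∫⁻ x : ℝ, ∫⁻ y : ℝ, f (x + y * Complex.I) := by
  rw [← Complex.volume_preserving_equiv_real_prod.symm.lintegral_comp hf,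
    Measure.volume_eq_prod, lintegral_prod _ (by fun_prop)]
  simp [Complex.mk_eq_add_mul_I]

/-- The square of the operator norm of the unnormalized transform. -/
noncomputable def segalConst (σ : ℝ) : ℝ := 2 * Real.pi / σ * √(Real.pi / σ)

theorem segalConst_pos (hσ : 0 < σ) : 0 < segalConst σ := by
  unfold segalConst; positivity

theorem memLp_mul_exp_sq (hσ : 0 < σ) (x : ℝ) :
    MemLp (fun t : ℝ => ((Real.exp (-(σ / 2) * (t - x) ^ 2) : ℝ) : ℂ)) 2 := by
  refine (memLp_cexp_quadratic (b := σ / 2) (by simpa using hσ) (σ * x)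
    (-(σ / 2) * x ^ 2)).congr_norm (by fun_prop) (Eventually.of_forall fun t => ?_)
  rw [Complex.ofReal_exp]
  congr 2
  push_cast
  ring

/-- For fixed `x`, Plancherel in `y` applies, the change of frequency variable giving `2π/σ`. By
Tonelli the window is then integrated over its centre `x`, giving `√(π/σ)` whatever `t` is. -/
theorem lintegral_enorm_segal_sq (hσ : 0 < σ) {φ : ℝ → ℂ} (hφ : MemLp φ 2) :
    ∫⁻ z, ‖segal σ φ z * gauss σ z‖ₑ ^ 2 =
      ENNReal.ofReal (segalConst σ) * ∫⁻ t, ‖φ t‖ₑ ^ 2 := by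
  have hcont : Continuous fun z => segal σ φ z * gauss σ z :=
    (differentiable_segal hσ hφ).continuous.mul
      (Complex.continuous_ofReal.comp (continuous_gauss σ))
  rw [lintegral_complex _ (hcont.measurable.enorm.pow_const 2)]
  have hsec : ∀ x : ℝ, ∫⁻ y : ℝ, ‖segal σ φ (x + y * Complex.I) * gauss σ (x + y * Complex.I)‖ₑ ^ 2
      = ENNReal.ofReal (2 * Real.pi / σ) *
        ∫⁻ t, ‖φ t‖ₑ ^ 2 * ENNReal.ofReal (Real.exp (-σ * (t - x) ^ 2)) := by
    intro x
    simp_rw [enorm_segal_mul_gauss]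
    rw [lintegral_comp_mul_left_real (fun y => ‖FourierTransform.fourier
        (fun t : ℝ => φ t * Real.exp (-(σ / 2) * (t - x) ^ 2)) y‖ₑ ^ 2)
        (a := -(σ / (2 * Real.pi))) (neg_ne_zero.2 (by positivity)),
      lintegral_enorm_fourier_sq]
    · congr 1
      · congr 1
        rw [inv_neg, abs_neg, inv_div, abs_of_pos (by positivity)]
      · refine lintegral_congr fun t => ?_
        rw [enorm_mul, mul_pow]
        congr 1
        rw [← ofReal_norm, ← ENNReal.ofReal_pow (norm_nonneg _), Complex.norm_real,
          Real.norm_eq_abs, Real.abs_exp, ← Real.exp_nat_mul]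
        congr 2
        push_cast
        ring
    · exact hφ.integrable_mul (memLp_mul_exp_sq hσ x)
    · have hb : MemLp (fun t : ℝ => ((Real.exp (-(σ / 2) * (t - x) ^ 2) : ℝ) : ℂ)) ∞ := by
        refine memLp_top_of_bound (by fun_prop) 1 (Eventually.of_forall fun t => ?_)
        rw [Complex.norm_real, Real.norm_eq_abs, Real.abs_exp, Real.exp_le_one_iff]
        have := sq_nonneg (t - x)
        nlinarith
      exact hb.mul (p := 2) (q := ∞) (r := 2) hφ
  simp_rw [hsec]
  rw [lintegral_const_mul' _ _ ENNReal.ofReal_ne_top, lintegral_lintegral_swap]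
  · have hin : ∀ t : ℝ, ∫⁻ x : ℝ, ‖φ t‖ₑ ^ 2 * ENNReal.ofReal (Real.exp (-σ * (t - x) ^ 2)) =
        ‖φ t‖ₑ ^ 2 * ENNReal.ofReal (√(Real.pi / σ)) := fun t => by
      rw [lintegral_const_mul _ (by fun_prop),
        lintegral_sub_left_eq_self (fun x => ENNReal.ofReal (Real.exp (-σ * x ^ 2))) t,
        ← integral_gaussian, ofReal_integral_eq_lintegral_ofReal (integrable_exp_neg_mul_sq hσ)
        (Eventually.of_forall fun x => (Real.exp_pos _).le)]
    simp_rw [hin]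
    rw [lintegral_mul_const' _ _ ENNReal.ofReal_ne_top, segalConst,
      ENNReal.ofReal_mul (by positivity)]
    ring
  · have h1 : AEMeasurable (fun t => ‖φ t‖ₑ ^ 2) (volume : Measure ℝ) := hφ.1.enorm.pow_const 2
    exact h1.comp_snd.mul (by fun_prop)

/-! ### Entire functions and the Gaussian weight -/

open ComplexConjugate

theorem continuous_gauss_ofReal (σ : ℝ) : Continuous fun z => (gauss σ z : ℂ) :=
  Complex.continuous_ofReal.comp (continuous_gauss σ)

theorem integrable_exp_neg_mul_sq_norm {b : ℝ} (hb : 0 < b) :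
    Integrable fun z : ℂ => Real.exp (-b * ‖z‖ ^ 2) := by
  have h := (GaussianFourier.integrable_cexp_neg_mul_sq_norm_add (V := ℂ) (b := b)
    (by simpa using hb) 0 0).norm
  refine h.congr (Eventually.of_forall fun z => ?_)
  simp only [Complex.norm_exp]
  congr 1
  rw [show (-(b : ℂ) * (‖z‖ : ℂ) ^ 2 + 0 * ((inner ℝ (0 : ℂ) z : ℝ) : ℂ)) =
    ((-b * ‖z‖ ^ 2 : ℝ) : ℂ) by push_cast; ring, Complex.ofReal_re]

/-- Continuous functions of exponential type are square integrable for the Gaussian weight. -/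
theorem memLp_mul_gauss_of_norm_le (hσ : 0 < σ) {f : ℂ → ℂ} (hf : Continuous f) {A C : ℝ}
    (h : ∀ z, ‖f z‖ ≤ C * Real.exp (A * ‖z‖)) : MemLp (fun z => f z * gauss σ z) 2 := by
  -- Half of the Gaussian exponent is given up to absorb the growth of `f`; `2A²/σ` is the maximum
  -- over real `r` of `A r - σ r² / 8`.
  have hbase : MemLp (fun z : ℂ =>
      (C * Real.exp (2 * A ^ 2 / σ)) * Real.exp (-(σ / 8) * ‖z‖ ^ 2)) 2 := by
    refine MemLp.const_mul ?_ _
    rw [memLp_two_iff_integrable_sq (by fun_prop)]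
    refine (integrable_exp_neg_mul_sq_norm (b := σ / 4) (by positivity)).congr
      (Eventually.of_forall fun z => ?_)
    simp only [← Real.exp_nat_mul]
    congr 1
    push_cast
    ring
  refine hbase.mono (hf.mul (continuous_gauss_ofReal σ)).aestronglyMeasurable
    (Eventually.of_forall fun z => ?_)
  have hC : 0 ≤ C := nonneg_of_mul_nonneg_left ((norm_nonneg _).trans (h z)) (Real.exp_pos _)
  rw [norm_mul, Complex.norm_real, gauss, Real.norm_eq_abs, Real.abs_exp,
    Real.norm_of_nonneg (by positivity)]
  calc ‖f z‖ * Real.exp (-(σ / 4) * ‖z‖ ^ 2)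
      ≤ C * Real.exp (A * ‖z‖) * Real.exp (-(σ / 4) * ‖z‖ ^ 2) := by gcongr; exact h z
    _ = C * Real.exp (A * ‖z‖ + -(σ / 4) * ‖z‖ ^ 2) := by rw [mul_assoc, ← Real.exp_add]
    _ ≤ C * Real.exp (2 * A ^ 2 / σ + -(σ / 8) * ‖z‖ ^ 2) := by
        refine mul_le_mul_of_nonneg_left (Real.exp_le_exp.2 ?_) hC
        have : 2 * A ^ 2 / σ + -(σ / 8) * ‖z‖ ^ 2 - (A * ‖z‖ + -(σ / 4) * ‖z‖ ^ 2) =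
          (σ * ‖z‖ - 4 * A) ^ 2 / (8 * σ) := by field_simp; ring
        have h0 : 0 ≤ (σ * ‖z‖ - 4 * A) ^ 2 / (8 * σ) := by positivity
        linarith
    _ = _ := by rw [Real.exp_add, mul_assoc]

theorem memLp_cexp_mul_gauss (hσ : 0 < σ) (c : ℂ) :
    MemLp (fun z => Complex.exp (c * z) * gauss σ z) 2 := by
  refine memLp_mul_gauss_of_norm_le hσ (by fun_prop) (A := ‖c‖) (C := 1) fun z => ?_
  rw [Complex.norm_exp, one_mul, Real.exp_le_exp]
  exact (Complex.re_le_norm _).trans (norm_mul_le _ _)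

theorem memLp_exp_norm_mul_gauss (hσ : 0 < σ) (A : ℝ) :
    MemLp (fun z : ℂ => (Real.exp (A * ‖z‖) : ℂ) * gauss σ z) 2 := by
  refine memLp_mul_gauss_of_norm_le hσ (by fun_prop) (A := A) (C := 1) fun z => ?_
  rw [Complex.norm_real, Real.norm_eq_abs, Real.abs_exp, one_mul]

theorem memLp_pow_mul_gauss (hσ : 0 < σ) (n : ℕ) :
    MemLp (fun z : ℂ => z ^ n * gauss σ z) 2 := by
  refine memLp_mul_gauss_of_norm_le hσ (by fun_prop) (A := 1) (C := n.factorial) fun z => ?_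
  rw [norm_pow, one_mul, mul_comm, ← div_le_iff₀ (by positivity)]
  exact Real.pow_div_factorial_le_exp _ (norm_nonneg z) n

theorem integrable_mul_gauss_sq {f h : ℂ → ℂ} (hf : MemLp (fun z => f z * gauss σ z) 2)
    (hh : MemLp (fun z => h z * gauss σ z) 2) :
    Integrable fun z => f z * h z * (gauss σ z : ℂ) ^ 2 := by
  refine (hf.integrable_mul hh).congr (Eventually.of_forall fun z => ?_)
  simp only [Pi.mul_apply]
  ring

theorem memLp_conj_mul_gauss {f : ℂ → ℂ} (hf : MemLp (fun z => f z * gauss σ z) 2) :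
    MemLp (fun z => conj (f z) * gauss σ z) 2 := by
  refine hf.star.congr_norm ?_ (Eventually.of_forall fun z => by simp)
  have := hf.star.1
  refine this.congr (Eventually.of_forall fun z => ?_)
  simp [mul_comm]

theorem measurePreserving_cexp_mul (θ : ℝ) :
    MeasurePreserving (fun z : ℂ => Complex.exp (θ * Complex.I) * z) := by
  have h := (rotation (Circle.exp θ)).measurePreserving
  convert h using 2
  simp

/-- The integral of an entire function against a radial weight, by averaging over rotations. -/
theorem integral_entire_mul_radial {F h : ℂ → ℂ} (hF : Differentiable ℂ F) (hc : Continuous h)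
    (hrad : ∀ (θ : ℝ) z, h (Complex.exp (θ * Complex.I) * z) = h z)
    (hint : Integrable fun z => F z * h z) :
    ∫ z, F z * h z = F 0 * ∫ z, h z := by
  have hFc := hF.continuous
  have hemb : ∀ θ : ℝ, MeasurableEmbedding fun z : ℂ => Complex.exp (θ * Complex.I) * z :=
    fun θ => measurableEmbedding_mulLeft₀ (Complex.exp_ne_zero _)
  have hrot : ∀ θ : ℝ, ∫ z, F (Complex.exp (θ * Complex.I) * z) * h z = ∫ z, F z * h z := by
    intro θ
    have := (measurePreserving_cexp_mul θ).integral_comp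
      (hemb θ) fun z => F z * h z
    simpa only [hrad] using this
  have hi : ∀ θ : ℝ, Integrable fun z => F (Complex.exp (θ * Complex.I) * z) * h z := fun θ => by
    have := (measurePreserving_cexp_mul θ).integrable_comp_of_integrable hint
    simpa [Function.comp_def, hrad] using this
  have hn : ∀ θ : ℝ, ∫ z, ‖F (Complex.exp (θ * Complex.I) * z) * h z‖ = ∫ z, ‖F z * h z‖ := by
    intro θ
    have := (measurePreserving_cexp_mul θ).integral_comp
      (hemb θ) fun z => ‖F z * h z‖
    simpa only [hrad] using this
  have hprod : Integrable (Function.uncurry fun (θ : ℝ) (z : ℂ) =>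
      F (Complex.exp (θ * Complex.I) * z) * h z)
      ((volume.restrict (Set.Ioc 0 (2 * Real.pi))).prod volume) := by
    rw [integrable_prod_iff (by
      refine Continuous.aestronglyMeasurable ?_
      simp only [Function.uncurry_def]
      fun_prop)]
    refine ⟨Eventually.of_forall fun θ => hi θ, ?_⟩
    simp only [Function.uncurry_apply_pair, hn]
    exact integrable_const _
  have hswap := integral_integral_swap hprod
  simp_rw [hrot] at hswap
  -- The mean value property of the entire function `w ↦ F(w z)` on the unit circle: its value at
  -- the centre is `F 0`, for every `z`.
  have hmean : ∀ z, ∫ θ in Set.Ioc 0 (2 * Real.pi), F (Complex.exp (θ * Complex.I) * z) * h z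
      = (2 * Real.pi : ℝ) * (F 0 * h z) := fun z => by
    rw [integral_mul_const, ← intervalIntegral.integral_of_le (by positivity)]
    have hd : Differentiable ℂ fun w => F (w * z) := by fun_prop
    have := DiffContOnCl.circleAverage (R := 1) (c := 0) hd.diffContOnCl
    rw [Real.circleAverage_def] at this
    simp only [circleMap_zero, Complex.ofReal_one, one_mul, zero_mul] at this
    rw [← this, Complex.real_smul, ← mul_assoc, ← mul_assoc, ← Complex.ofReal_mul,
      mul_inv_cancel₀ (by positivity), Complex.ofReal_one, one_mul]
  simp_rw [hmean] at hswap
  rw [integral_const_mul, integral_const_mul] at hswap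
  simp only [MeasurableSet.univ, measureReal_restrict_apply, Set.univ_inter,
    integral_const, Real.volume_real_Ioc, sub_zero, Complex.real_smul] at hswap
  rw [max_eq_left (by positivity)] at hswap
  exact mul_left_cancel₀ (by simp [Real.pi_ne_zero]) hswap

theorem gauss_sq (σ : ℝ) (z : ℂ) : (gauss σ z : ℂ) ^ 2 = (Real.exp (-(σ / 2) * ‖z‖ ^ 2) : ℝ) := by
  rw [gauss, ← Complex.ofReal_pow, ← Real.exp_nat_mul]
  congr 2
  push_cast
  ring

theorem gauss_cexp_mul (σ θ : ℝ) (z : ℂ) :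
    gauss σ (Complex.exp (θ * Complex.I) * z) = gauss σ z := by
  rw [gauss, norm_mul, Complex.norm_exp_ofReal_mul_I, one_mul, gauss]

theorem integral_norm_pow_mul_gauss_sq (hσ : 0 < σ) (n : ℕ) :
    ∫ z : ℂ, ‖z‖ ^ (2 * n) * Real.exp (-(σ / 2) * ‖z‖ ^ 2) =
      2 * Real.pi / σ * ((2 / σ) ^ n * n.factorial) := by
  have h := Complex.integral_rpow_mul_exp_neg_mul_rpow (p := 2) (q := (2 * n : ℕ)) (b := σ / 2)
    one_le_two ((by norm_num : (-2 : ℝ) < 0).trans_le (Nat.cast_nonneg _)) (by positivity)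
  have e1 : (((2 * n : ℕ) : ℝ) + 2) / 2 = n + 1 := by push_cast; ring
  have e2 : -(((2 * n : ℕ) : ℝ) + 2) / 2 = -((n + 1 : ℕ) : ℝ) := by push_cast; ring
  rw [e1, e2, Real.Gamma_nat_eq_factorial, Real.rpow_neg (by positivity), Real.rpow_natCast] at h
  simp only [Real.rpow_natCast, Real.rpow_ofNat] at h
  rw [h, div_pow, div_pow, pow_succ σ, pow_succ 2]
  field_simp

theorem integral_gauss_sq (hσ : 0 < σ) : ∫ z, (gauss σ z : ℂ) ^ 2 = (2 * Real.pi / σ : ℝ) := by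
  have h : ∫ z : ℂ, Real.exp (-(σ / 2) * ‖z‖ ^ 2) = 2 * Real.pi / σ := by
    simpa using integral_norm_pow_mul_gauss_sq hσ 0
  simp_rw [gauss_sq]
  exact (integral_ofReal (𝕜 := ℂ)).trans (congrArg _ h)

/-- The antiholomorphic exponential cancels the terms `a z̄` and `|a|²` of `|z + a|²`. Only a
holomorphic factor is left beside the radial weight, as averaging over rotations requires. -/
theorem gauss_shift (σ : ℝ) (a z : ℂ) :
    (gauss σ (z + a) : ℂ) ^ 2 * Complex.exp (σ / 2 * a * conj (z + a)) =
      (gauss σ z : ℂ) ^ 2 * Complex.exp (-(σ / 2) * conj a * z) := by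
  rw [gauss_sq, gauss_sq, Complex.ofReal_exp, Complex.ofReal_exp, ← Complex.exp_add,
    ← Complex.exp_add]
  congr 1
  push_cast
  rw [← Complex.mul_conj', ← Complex.mul_conj', map_add]
  ring

/-- The reproducing formula of the Segal--Bargmann space. -/
theorem reproducing_formula (hσ : 0 < σ) {F : ℂ → ℂ} (hF : Differentiable ℂ F)
    (hF2 : MemLp (fun z => F z * gauss σ z) 2) (a : ℂ) :
    ∫ z, F z * Complex.exp (σ / 2 * a * conj z) * (gauss σ z : ℂ) ^ 2 =
      F a * (2 * Real.pi / σ : ℝ) := by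
  set H : ℂ → ℂ := fun z => F z * Complex.exp (σ / 2 * a * conj z) * (gauss σ z : ℂ) ^ 2 with hH
  have hHi : Integrable H := by
    have h := memLp_conj_mul_gauss (memLp_cexp_mul_gauss hσ (σ / 2 * conj a))
    refine (integrable_mul_gauss_sq hF2 h).congr (Eventually.of_forall fun z => ?_)
    simp only [hH, ← Complex.exp_conj, map_mul, map_div₀, Complex.conj_ofReal, Complex.conj_conj,
      map_ofNat]
  have hshift : ∀ z, H (z + a) =
      F (z + a) * Complex.exp (-(σ / 2) * conj a * z) * (gauss σ z : ℂ) ^ 2 := fun z => by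
    have := gauss_shift σ a z
    simp only [hH]
    linear_combination F (z + a) * this
  have hi2 := hHi.comp_add_right a
  -- After translation by `a` the integrand is the entire function `F(z + a) exp(-(σ/2) ā z)` times
  -- a radial weight, and the value of that function at `0` is `F a`.
  rw [← integral_add_right_eq_self H a]
  simp_rw [hshift] at hi2 ⊢
  refine (integral_entire_mul_radial (h := fun z => (gauss σ z : ℂ) ^ 2) (by fun_prop)
    ((continuous_gauss_ofReal σ).pow 2) (fun θ z => by rw [gauss_cexp_mul]) hi2).trans ?_
  rw [integral_gauss_sq hσ]
  simp

/-- By the reproducing formula, the pairing with the exponential of parameter `ā` is a nonzero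
multiple of `F a`. -/
theorem eq_zero_of_forall_integral_conj_cexp (hσ : 0 < σ) {F : ℂ → ℂ} (hF : Differentiable ℂ F)
    (hF2 : MemLp (fun z => F z * gauss σ z) 2)
    (h : ∀ a : ℂ, ∫ z, F z * conj (Complex.exp (σ / 2 * a * z)) * (gauss σ z : ℂ) ^ 2 = 0) :
    F = 0 := by
  funext a
  have h1 := reproducing_formula hσ hF hF2 a
  have h2 := h (conj a)
  simp only [← Complex.exp_conj, map_mul, map_div₀, Complex.conj_ofReal, Complex.conj_conj,
    map_ofNat] at h2
  rw [h2] at h1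
  have h3 : ((2 * Real.pi / σ : ℝ) : ℂ) ≠ 0 := by
    rw [Complex.ofReal_ne_zero]; positivity
  exact (mul_eq_zero.1 h1.symm).resolve_right h3

/-- Monomials are complete in the Segal--Bargmann space. -/
theorem eq_zero_of_forall_integral_conj_pow (hσ : 0 < σ) {F : ℂ → ℂ} (hF : Differentiable ℂ F)
    (hF2 : MemLp (fun z => F z * gauss σ z) 2)
    (h : ∀ n : ℕ, ∫ z, F z * conj (z ^ n) * (gauss σ z : ℂ) ^ 2 = 0) : F = 0 := by
  refine eq_zero_of_forall_integral_conj_cexp hσ hF hF2 fun a => ?_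
  have hFc := hF.continuous
  have hg := continuous_gauss_ofReal σ
  set b : ℂ := σ / 2 * a
  -- Majorant for integrating the exponential series term by term. Its sum `|F| e^{|b||z|} g²` is
  -- integrable as a product of two functions that are square integrable for the weight.
  have hs : ∀ z : ℂ, HasSum (fun n : ℕ => ‖F z‖ * (‖b‖ * ‖z‖) ^ n / n.factorial * gauss σ z ^ 2)
      (‖F z‖ * Real.exp (‖b‖ * ‖z‖) * gauss σ z ^ 2) := fun z => by
    have := (NormedSpace.expSeries_div_hasSum_exp (𝔸 := ℝ) (‖b‖ * ‖z‖)).mul_left ‖F z‖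
    rw [← Real.exp_eq_exp_ℝ] at this
    simpa only [mul_div_assoc] using this.mul_right (gauss σ z ^ 2)
  have hlim : ∀ z : ℂ, HasSum
      (fun n : ℕ => F z * conj ((b * z) ^ n / n.factorial) * (gauss σ z : ℂ) ^ 2)
      (F z * conj (Complex.exp (b * z)) * (gauss σ z : ℂ) ^ 2) := fun z => by
    have h1 : HasSum (fun n : ℕ => (b * z) ^ n / n.factorial) (Complex.exp (b * z)) := by
      rw [Complex.exp_eq_exp_ℂ]
      exact NormedSpace.expSeries_div_hasSum_exp (𝔸 := ℂ) (b * z)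
    exact ((Complex.hasSum_conj'.2 (by simpa only [Complex.conj_conj] using h1)).mul_left
      (F z)).mul_right _
  have hmeas : ∀ n : ℕ, AEStronglyMeasurable
      (fun z : ℂ => F z * conj ((b * z) ^ n / n.factorial) * (gauss σ z : ℂ) ^ 2) volume :=
    fun n => by
      have : Continuous fun z : ℂ => conj ((b * z) ^ n / n.factorial) :=
        Complex.continuous_conj.comp (by fun_prop)
      exact ((hFc.mul this).mul (hg.pow 2)).aestronglyMeasurable
  have hbound : ∀ (n : ℕ) (z : ℂ),
      ‖F z * conj ((b * z) ^ n / n.factorial) * (gauss σ z : ℂ) ^ 2‖ ≤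
        ‖F z‖ * (‖b‖ * ‖z‖) ^ n / n.factorial * gauss σ z ^ 2 := fun n z => by
    rw [norm_mul, norm_mul, RCLike.norm_conj, norm_div, norm_pow, norm_mul, norm_pow,
      Complex.norm_real, Complex.norm_natCast, Real.norm_eq_abs, sq_abs, mul_div_assoc]
  have hint : Integrable fun z : ℂ => ∑' n : ℕ,
      ‖F z‖ * (‖b‖ * ‖z‖) ^ n / n.factorial * gauss σ z ^ 2 := by
    simp_rw [(hs _).tsum_eq]
    refine (integrable_mul_gauss_sq hF2
      (memLp_exp_norm_mul_gauss hσ ‖b‖)).norm.congr (Eventually.of_forall fun z => ?_)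
    simp only [norm_mul, norm_pow, Complex.norm_real, Real.norm_eq_abs, Real.abs_exp, sq_abs]
  have hsum := hasSum_integral_of_dominated_convergence _ hmeas
    (fun n => Eventually.of_forall (hbound n)) (Eventually.of_forall fun z => (hs z).summable)
    hint (Eventually.of_forall hlim)
  have hz : ∀ n : ℕ, ∫ z, F z * conj ((b * z) ^ n / n.factorial) * (gauss σ z : ℂ) ^ 2 = 0 := by
    intro n
    have : ∀ z, F z * conj ((b * z) ^ n / n.factorial) * (gauss σ z : ℂ) ^ 2 =
        conj (b ^ n / n.factorial) * (F z * conj (z ^ n) * (gauss σ z : ℂ) ^ 2) := fun z => by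
      simp only [map_div₀, map_mul, mul_pow]
      ring
    simp_rw [this]
    rw [integral_const_mul, h n, mul_zero]
  simp_rw [hz] at hsum
  exact hsum.unique hasSum_zero

/-! ### Orthogonality of the monomials -/

/-- The integrand is `z^(n-m)`, which vanishes at `0`, times the radial factor `|z|^(2m) g²`. -/
theorem integral_pow_mul_conj_pow_of_lt (hσ : 0 < σ) {m n : ℕ} (h : m < n) :
    ∫ z : ℂ, z ^ n * conj (z ^ m) * (gauss σ z : ℂ) ^ 2 = 0 := by
  have hi := integrable_mul_gauss_sq (memLp_pow_mul_gauss hσ n)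
    (memLp_conj_mul_gauss (memLp_pow_mul_gauss hσ m))
  have e : ∀ z : ℂ, z ^ n * conj (z ^ m) * (gauss σ z : ℂ) ^ 2 =
      z ^ (n - m) * (((‖z‖ : ℂ) ^ 2) ^ m * (gauss σ z : ℂ) ^ 2) := fun z => by
    rw [← Complex.mul_conj', mul_pow, map_pow, ← Nat.sub_add_cancel h.le, pow_add,
      Nat.add_sub_cancel]
    ring
  simp_rw [e] at hi ⊢
  rw [integral_entire_mul_radial (F := fun z : ℂ => z ^ (n - m)) (by fun_prop) ?_ ?_ hi,
    zero_pow (Nat.sub_ne_zero_of_lt h), zero_mul]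
  · exact ((by fun_prop : Continuous fun z : ℂ => ((‖z‖ : ℂ) ^ 2) ^ m)).mul
      ((continuous_gauss_ofReal σ).pow 2)
  · intro θ z
    rw [gauss_cexp_mul, norm_mul, Complex.norm_exp_ofReal_mul_I, one_mul]

theorem integral_pow_mul_conj_pow_of_ne (hσ : 0 < σ) {m n : ℕ} (h : m ≠ n) :
    ∫ z : ℂ, z ^ n * conj (z ^ m) * (gauss σ z : ℂ) ^ 2 = 0 := by
  rcases lt_or_gt_of_ne h with h | h
  · exact integral_pow_mul_conj_pow_of_lt hσ h
  · have := congrArg conj (integral_pow_mul_conj_pow_of_lt hσ h)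
    rw [← integral_conj, map_zero] at this
    rw [← this]
    refine integral_congr_ae (Eventually.of_forall fun z => ?_)
    simp only [map_mul, map_pow, Complex.conj_conj, Complex.conj_ofReal]
    ring

theorem integral_pow_mul_conj_pow_self (hσ : 0 < σ) (n : ℕ) :
    ∫ z : ℂ, z ^ n * conj (z ^ n) * (gauss σ z : ℂ) ^ 2 =
      (2 * Real.pi / σ * ((2 / σ) ^ n * n.factorial) : ℝ) := by
  rw [← integral_norm_pow_mul_gauss_sq hσ n]
  refine Eq.trans ?_ (integral_ofReal (𝕜 := ℂ))
  refine integral_congr_ae (Eventually.of_forall fun z => ?_)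
  simp only [gauss_sq, Complex.mul_conj', norm_pow, Complex.coe_algebraMap, Complex.ofReal_mul,
    Complex.ofReal_pow]
  ring

/-! ### The unitary transform and its range -/

theorem memLp_segal_mul_gauss (hσ : 0 < σ) {φ : ℝ → ℂ} (hφ : MemLp φ 2) :
    MemLp (fun z => segal σ φ z * gauss σ z) 2 := by
  refine ⟨((differentiable_segal hσ hφ).continuous.mul
    (continuous_gauss_ofReal σ)).aestronglyMeasurable, ?_⟩
  have h : eLpNorm (fun z => segal σ φ z * gauss σ z) 2 volume ^ 2 < ∞ := by
    rw [eLpNorm_two_sq, lintegral_enorm_segal_sq hσ hφ, ← eLpNorm_two_sq]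
    exact ENNReal.mul_lt_top ENNReal.ofReal_lt_top (ENNReal.pow_lt_top hφ.2)
  exact (ENNReal.pow_lt_top_iff.1 h).resolve_right two_ne_zero

theorem segal_add (hσ : 0 < σ) {φ ψ : ℝ → ℂ} (hφ : MemLp φ 2) (hψ : MemLp ψ 2) (z : ℂ) :
    segal σ (fun t => φ t + ψ t) z = segal σ φ z + segal σ ψ z := by
  simp only [segal, add_mul]
  exact integral_add (integrable_mul_segalKernel hσ hφ z) (integrable_mul_segalKernel hσ hψ z)

theorem segal_const_mul (c : ℂ) (φ : ℝ → ℂ) (z : ℂ) :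
    segal σ (fun t => c * φ t) z = c * segal σ φ z := by
  simp only [segal, mul_assoc]
  exact integral_const_mul _ _

theorem segal_congr_ae {φ ψ : ℝ → ℂ} (h : φ =ᵐ[volume] ψ) : segal σ φ = segal σ ψ := by
  funext z
  refine integral_congr_ae ?_
  filter_upwards [h] with t ht
  rw [ht]

/-- The normalizing factor of the Segal--Bargmann transform. -/
noncomputable def segalNorm (σ : ℝ) : ℝ := (√(segalConst σ))⁻¹

theorem segalNorm_pos (hσ : 0 < σ) : 0 < segalNorm σ :=
  inv_pos.2 (Real.sqrt_pos.2 (segalConst_pos hσ))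

theorem memLp_segalNorm_mul (hσ : 0 < σ) {φ : ℝ → ℂ} (hφ : MemLp φ 2) :
    MemLp (fun z => (segalNorm σ : ℂ) * (segal σ φ z * gauss σ z)) 2 :=
  (memLp_segal_mul_gauss hσ hφ).const_mul _

/-- The unitary Segal--Bargmann transform, with values in `L²(ℂ)`. -/
noncomputable def segalIsometry (hσ : 0 < σ) :
    Lp ℂ 2 (volume : Measure ℝ) →ₗᵢ[ℂ] Lp ℂ 2 (volume : Measure ℂ) where
  toFun φ := (memLp_segalNorm_mul hσ (Lp.memLp φ)).toLp _
  map_add' φ ψ := by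
    rw [← MemLp.toLp_add]
    refine MemLp.toLp_congr _ _ (Eventually.of_forall fun z => ?_)
    rw [segal_congr_ae (Lp.coeFn_add φ ψ)]
    have := segal_add hσ (Lp.memLp φ) (Lp.memLp ψ) z
    simp only [Pi.add_apply]
    rw [← mul_add, ← add_mul, ← this]
    rfl
  map_smul' c φ := by
    simp only [RingHom.id_apply]
    rw [← MemLp.toLp_const_smul]
    refine MemLp.toLp_congr _ _ (Eventually.of_forall fun z => ?_)
    rw [segal_congr_ae (Lp.coeFn_smul c φ)]
    have : segal σ (c • ⇑φ) z = c * segal σ φ z := segal_const_mul c φ z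
    simp only [Pi.smul_apply, smul_eq_mul, this]
    ring
  norm_map' φ := by
    change ‖(memLp_segalNorm_mul hσ (Lp.memLp φ)).toLp _‖ = ‖φ‖
    have h : ‖(memLp_segalNorm_mul hσ (Lp.memLp φ)).toLp _‖ₑ ^ 2 = ‖φ‖ₑ ^ 2 := by
      rw [Lp.enorm_toLp, Lp.enorm_def, eLpNorm_two_sq, eLpNorm_two_sq]
      simp_rw [enorm_mul _ (segal _ _ _ * _), mul_pow]
      rw [lintegral_const_mul' _ _ (by simp), lintegral_enorm_segal_sq hσ (Lp.memLp φ), ← mul_assoc,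
        ← ofReal_norm, Complex.norm_real, Real.norm_of_nonneg (segalNorm_pos hσ).le,
        ← ENNReal.ofReal_pow (segalNorm_pos hσ).le, ← ENNReal.ofReal_mul (by positivity), segalNorm,
        inv_pow, Real.sq_sqrt (segalConst_pos hσ).le, inv_mul_cancel₀ (segalConst_pos hσ).ne',
        ENNReal.ofReal_one, one_mul]
    have h2 := (ENNReal.pow_right_strictMono two_ne_zero).injective h
    simpa [← toReal_enorm] using congrArg ENNReal.toReal h2

theorem coeFn_segalIsometry (hσ : 0 < σ) {φ : ℝ → ℂ} (hφ : MemLp φ 2) :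
    segalIsometry hσ (hφ.toLp φ) =ᵐ[volume]
      fun z => (segalNorm σ : ℂ) * (segal σ φ z * gauss σ z) := by
  refine (MemLp.coeFn_toLp (memLp_segalNorm_mul hσ (Lp.memLp (hφ.toLp φ)))).trans ?_
  rw [segal_congr_ae hφ.coeFn_toLp]

theorem memLp_cexp_neg_sq (hσ : 0 < σ) (a : ℂ) :
    MemLp (fun t : ℝ => Complex.exp (-(σ / 2 : ℂ) * t ^ 2 + σ * a * t + 0)) 2 :=
  memLp_cexp_quadratic (by simpa using hσ) _ _

/-- This Gaussian integral places every exponential, that is every reproducing kernel, in the range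
of the transform; surjectivity is deduced from it. -/
theorem segal_cexp (hσ : 0 < σ) (a z : ℂ) :
    segal σ (fun t : ℝ => Complex.exp (-(σ / 2 : ℂ) * t ^ 2 + σ * a * t + 0)) z =
      (Real.pi / σ : ℂ) ^ (1 / 2 : ℂ) * Complex.exp (σ / 4 * a ^ 2) *
        Complex.exp (σ / 2 * a * z) := by
  have hσ' : (σ : ℂ) ≠ 0 := Complex.ofReal_ne_zero.2 hσ.ne'
  have h := integral_cexp_quadratic (b := -σ) (by simpa using hσ) (σ * (a + z))
    (-(σ / 4) * z ^ 2)
  rw [segal, mul_assoc, ← Complex.exp_add]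
  refine Eq.trans (integral_congr_ae (Eventually.of_forall fun t => ?_)) (h.trans ?_)
  · simp only [segalKernel, ← Complex.exp_add]
    congr 1
    ring
  · rw [neg_neg]
    congr 2
    field_simp
    ring

theorem inner_toLp_eq_integral {f h : ℂ → ℂ} (hf : MemLp (fun z => f z * gauss σ z) 2)
    (hh : MemLp (fun z => h z * gauss σ z) 2) :
    inner ℂ (hh.toLp _) (hf.toLp _) = ∫ z, f z * conj (h z) * (gauss σ z : ℂ) ^ 2 := by
  rw [L2.inner_def]
  refine integral_congr_ae ?_
  filter_upwards [hf.coeFn_toLp, hh.coeFn_toLp] with z h1 h2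
  rw [h1, h2, RCLike.inner_apply, map_mul, Complex.conj_ofReal]
  ring

/-- The Segal--Bargmann transform maps onto the space of entire functions that are square
integrable for the Gaussian weight. -/
theorem exists_segal_eq (hσ : 0 < σ) {F : ℂ → ℂ} (hF : Differentiable ℂ F)
    (hF2 : MemLp (fun z => F z * gauss σ z) 2) : ∃ φ : ℝ → ℂ, MemLp φ 2 ∧ segal σ φ = F := by
  set T := segalIsometry hσ
  set u := hF2.toLp _ with hu
  -- For an isometry `T`, the difference `u - T T* u` is orthogonal to the range of `T`, hence to
  -- all exponentials. As it comes from an entire function, it vanishes.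
  set φ := ContinuousLinearMap.adjoint T.toContinuousLinearMap u with hφdef
  have hφ : MemLp (fun t => (segalNorm σ : ℂ) * φ t) 2 := (Lp.memLp φ).const_mul _
  refine ⟨_, hφ, ?_⟩
  have hD : Differentiable ℂ (F - segal σ fun t => (segalNorm σ : ℂ) * φ t) :=
    hF.sub (differentiable_segal hσ hφ)
  have hDmem : MemLp (fun z => (F - segal σ fun t => (segalNorm σ : ℂ) * φ t) z * gauss σ z) 2 := by
    refine (hF2.sub (memLp_segal_mul_gauss hσ hφ)).ae_eq (Eventually.of_forall fun z => ?_)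
    simp [sub_mul]
  have hDu : hDmem.toLp _ = u - T φ := by
    have hTφ : T φ = (memLp_segal_mul_gauss hσ hφ).toLp _ := by
      refine MemLp.toLp_congr (memLp_segalNorm_mul hσ (Lp.memLp φ)) _
        (Eventually.of_forall fun z => ?_)
      simp only [segal_const_mul, mul_assoc]
    rw [hTφ, hu, ← MemLp.toLp_sub]
    refine MemLp.toLp_congr _ _ (Eventually.of_forall fun z => ?_)
    simp [sub_mul]
  refine (sub_eq_zero.1 (eq_zero_of_forall_integral_conj_cexp hσ hD hDmem fun a => ?_)).symm
  have hK := memLp_cexp_mul_gauss hσ (σ / 2 * a)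
  rw [← inner_toLp_eq_integral hDmem hK, hDu]
  have hψ := memLp_cexp_neg_sq hσ a
  set c : ℂ := segalNorm σ * ((Real.pi / σ : ℂ) ^ (1 / 2 : ℂ) * Complex.exp (σ / 4 * a ^ 2))
    with hc
  have hc0 : c ≠ 0 := by
    have h1 : (segalNorm σ : ℂ) ≠ 0 := Complex.ofReal_ne_zero.2 (segalNorm_pos hσ).ne'
    have h2 : (Real.pi / σ : ℂ) ≠ 0 :=
      div_ne_zero (Complex.ofReal_ne_zero.2 Real.pi_ne_zero) (Complex.ofReal_ne_zero.2 hσ.ne')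
    simp [hc, h1, Complex.cpow_eq_zero_iff, h2]
  have hTψ : T (hψ.toLp _) = c • hK.toLp _ := by
    rw [← MemLp.toLp_const_smul]
    refine Lp.ext ((coeFn_segalIsometry hσ hψ).trans
      (EventuallyEq.trans (Eventually.of_forall fun z => ?_) (MemLp.coeFn_toLp _).symm))
    simp only [segal_cexp hσ, Pi.smul_apply, smul_eq_mul, hc]
    ring
  have h0 : inner ℂ (T (hψ.toLp _)) (u - T φ) = 0 := by
    rw [inner_sub_right, LinearIsometry.inner_map_map, hφdef,
      ContinuousLinearMap.adjoint_inner_right]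
    exact sub_self _
  rw [hTψ, inner_smul_left] at h0
  exact (mul_eq_zero.1 h0).resolve_left (by simpa using hc0)

/-! ### Expansion in monomials -/

/-- The monomial `z ^ n` as an element of `L²`, with the Gaussian weight included. -/
noncomputable def monomialLp (hσ : 0 < σ) (n : ℕ) : Lp ℂ 2 (volume : Measure ℂ) :=
  (memLp_pow_mul_gauss hσ n).toLp _

theorem inner_monomialLp_of_ne (hσ : 0 < σ) {m n : ℕ} (h : m ≠ n) :
    inner ℂ (monomialLp hσ m) (monomialLp hσ n) = 0 := by
  rw [monomialLp, monomialLp, inner_toLp_eq_integral, integral_pow_mul_conj_pow_of_ne hσ h]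

theorem inner_monomialLp_self (hσ : 0 < σ) (n : ℕ) :
    inner ℂ (monomialLp hσ n) (monomialLp hσ n) =
      (2 * Real.pi / σ * ((2 / σ) ^ n * n.factorial) : ℝ) := by
  rw [monomialLp, inner_toLp_eq_integral, integral_pow_mul_conj_pow_self hσ]

theorem inner_monomialLp_self_ne_zero (hσ : 0 < σ) (n : ℕ) :
    inner ℂ (monomialLp hσ n) (monomialLp hσ n) ≠ 0 := by
  rw [inner_monomialLp_self, Complex.ofReal_ne_zero]
  positivity

/-- The monomials are pulled back to `L²(ℝ)`, where their normalized preimages `h n` form a Hilbert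
basis; the expansion of the preimage of `F` is then pushed forward by the isometry. In this way no
completeness of the space of entire functions is needed beforehand. -/
theorem exists_hasSum_monomialLp (hσ : 0 < σ) {F : ℂ → ℂ} (hF : Differentiable ℂ F)
    (hF2 : MemLp (fun z => F z * gauss σ z) 2) :
    ∃ a : ℕ → ℂ, HasSum (fun n => a n • monomialLp hσ n) (hF2.toLp _) := by
  set T := segalIsometry hσ
  have hrange : ∀ {G : ℂ → ℂ} (hG : Differentiable ℂ G)
      (hG2 : MemLp (fun z => G z * gauss σ z) 2), ∃ φ, T φ = hG2.toLp _ := by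
    intro G hG hG2
    obtain ⟨φ, hφ, rfl⟩ := exists_segal_eq hσ hG hG2
    refine ⟨(segalNorm σ : ℂ)⁻¹ • hφ.toLp φ, ?_⟩
    have h1 : (segalNorm σ : ℂ) ≠ 0 := Complex.ofReal_ne_zero.2 (segalNorm_pos hσ).ne'
    rw [map_smul, inv_smul_eq_iff₀ h1, ← MemLp.toLp_const_smul]
    exact Lp.ext ((coeFn_segalIsometry hσ hφ).trans (MemLp.coeFn_toLp _).symm)
  choose h hh using fun n : ℕ => hrange (G := fun z => z ^ n) (by fun_prop)
    (memLp_pow_mul_gauss hσ n)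
  have hne : ∀ n, h n ≠ 0 := fun n h0 => inner_monomialLp_self_ne_zero hσ n (by
    rw [monomialLp, ← hh n, h0, map_zero, inner_zero_left])
  have horth : Orthonormal ℂ fun n => ((‖h n‖ : ℂ)⁻¹) • h n := by
    refine ⟨fun n => ?_, fun m n hmn => ?_⟩
    · exact norm_smul_inv_norm (hne n)
    · change inner ℂ ((‖h m‖ : ℂ)⁻¹ • h m) ((‖h n‖ : ℂ)⁻¹ • h n) = 0
      rw [inner_smul_left, inner_smul_right, ← T.inner_map_map, hh, hh]
      have := inner_monomialLp_of_ne hσ hmn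
      rw [monomialLp, monomialLp] at this
      rw [this, mul_zero, mul_zero]
  -- If `ψ` is orthogonal to every `h n`, its transform is orthogonal to every monomial and so is
  -- zero; the isometry then forces `ψ = 0`.
  have hbot : (Submodule.span ℂ (Set.range fun n => ((‖h n‖ : ℂ)⁻¹) • h n))ᗮ = ⊥ := by
    rw [Submodule.eq_bot_iff]
    intro ψ hψ
    have hψ2 := Lp.memLp ψ
    have hzero : segal σ ψ = 0 := by
      refine eq_zero_of_forall_integral_conj_pow hσ (differentiable_segal hσ hψ2)
        (memLp_segal_mul_gauss hσ hψ2) fun n => ?_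
      have h1 := (Submodule.mem_orthogonal _ _).1 hψ _
        (Submodule.subset_span (Set.mem_range_self n))
      rw [inner_smul_left, ← T.inner_map_map, hh] at h1
      have h2 := (mul_eq_zero.1 h1).resolve_left (by simpa using hne n)
      have h3 : T ψ = (segalNorm σ : ℂ) • (memLp_segal_mul_gauss hσ hψ2).toLp _ := by
        rw [← MemLp.toLp_const_smul]
        rfl
      rw [h3, inner_smul_right, inner_toLp_eq_integral] at h2
      exact (mul_eq_zero.1 h2).resolve_left
        (Complex.ofReal_ne_zero.2 (segalNorm_pos hσ).ne')
    rw [← norm_eq_zero, ← T.norm_map, norm_eq_zero]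
    refine Lp.ext ((MemLp.coeFn_toLp (memLp_segalNorm_mul hσ hψ2)).trans ?_)
    refine EventuallyEq.trans (Eventually.of_forall fun z => ?_) (Lp.coeFn_zero _ _ _).symm
    simp [hzero]
  obtain ⟨φ, hφ⟩ := hrange hF hF2
  have hs := ((HilbertBasis.mkOfOrthogonalEqBot horth hbot).hasSum_repr φ).mapL
    T.toContinuousLinearMap
  refine ⟨fun n => (HilbertBasis.mkOfOrthogonalEqBot horth hbot).repr φ n * (‖h n‖ : ℂ)⁻¹, ?_⟩
  rw [← hφ]
  refine hs.congr_fun fun n => ?_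
  rw [HilbertBasis.coe_mkOfOrthogonalEqBot]
  simp only [LinearIsometry.coe_toContinuousLinearMap, map_smul, hh, mul_smul]
  rfl

theorem enorm_toLp_sub_sum (hσ : 0 < σ) {F : ℂ → ℂ}
    (hF2 : MemLp (fun z => F z * gauss σ z) 2 volume) (a : ℕ → ℂ) (N : ℕ) :
    ‖hF2.toLp _ - ∑ k ∈ Finset.range N, a k • monomialLp hσ k‖ₑ =
      eLpNorm (fun z => F z * gauss σ z - ∑ k ∈ Finset.range N, a k * (z ^ k * gauss σ z)) 2
        volume := by
  have hsum : ⇑(∑ k ∈ Finset.range N, a k • monomialLp hσ k) =ᵐ[volume]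
      fun z => ∑ k ∈ Finset.range N, a k * (z ^ k * gauss σ z) := by
    induction N with
    | zero =>
      simp only [Finset.range_zero, Finset.sum_empty]
      exact Lp.coeFn_zero _ _ _
    | succ N ih =>
      simp only [Finset.sum_range_succ]
      filter_upwards [Lp.coeFn_add (∑ k ∈ Finset.range N, a k • monomialLp hσ k)
        (a N • monomialLp hσ N), ih, Lp.coeFn_smul (a N) (monomialLp hσ N),
        (memLp_pow_mul_gauss hσ N).coeFn_toLp] with z h1 h2 h3 h4
      rw [h1, Pi.add_apply, h2, h3, Pi.smul_apply, smul_eq_mul, monomialLp, h4]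
  rw [Lp.enorm_def]
  refine eLpNorm_congr_ae ?_
  filter_upwards [Lp.coeFn_sub (hF2.toLp _) (∑ k ∈ Finset.range N, a k • monomialLp hσ k),
    hF2.coeFn_toLp, hsum] with z h1 h2 h3
  rw [h1, Pi.sub_apply, h2, h3]

/-- Expansion in monomials in the Segal--Bargmann space. -/
theorem existsUnique_monomial_expansion (hσ : 0 < σ) {F : ℂ → ℂ} (hF : Differentiable ℂ F)
    (hF2 : MemLp (fun z => F z * gauss σ z) 2 volume) :
    ∃! a : ℕ → ℂ, Tendsto (fun N : ℕ => eLpNorm (fun z => F z * gauss σ z -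
      ∑ k ∈ Finset.range N, a k * (z ^ k * gauss σ z)) 2 volume) atTop (𝓝 0) := by
  simp_rw [← enorm_toLp_sub_sum hσ hF2]
  have hiff : ∀ a : ℕ → ℂ, Tendsto (fun N : ℕ =>
      ‖hF2.toLp _ - ∑ k ∈ Finset.range N, a k • monomialLp hσ k‖ₑ) atTop (𝓝 0) ↔
      Tendsto (fun N : ℕ => ∑ k ∈ Finset.range N, a k • monomialLp hσ k) atTop
        (𝓝 (hF2.toLp _)) := fun a => by
    rw [tendsto_iff_edist_tendsto_0]
    simp_rw [edist_comm _ (hF2.toLp _), edist_eq_enorm_sub]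
  simp_rw [hiff]
  obtain ⟨a, ha⟩ := exists_hasSum_monomialLp hσ hF hF2
  refine ⟨a, ha.tendsto_sum_nat, fun b hb => ?_⟩
  -- Pairing the partial sums with the `n`-th monomial gives a sequence that is constant once `N >
  -- n`, so the limit determines `c n`.
  have hcoef : ∀ c : ℕ → ℂ, Tendsto (fun N : ℕ => ∑ k ∈ Finset.range N, c k • monomialLp hσ k)
      atTop (𝓝 (hF2.toLp _)) → ∀ n, c n * inner ℂ (monomialLp hσ n) (monomialLp hσ n) =
        inner ℂ (monomialLp hσ n) (hF2.toLp _) := fun c hc n => by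
    refine tendsto_nhds_unique (f := fun N => inner ℂ (monomialLp hσ n)
      (∑ k ∈ Finset.range N, c k • monomialLp hσ k)) (l := atTop) ?_ (tendsto_const_nhds.inner hc)
    refine tendsto_const_nhds.congr' ?_
    filter_upwards [eventually_gt_atTop n] with N hN
    rw [inner_sum, Finset.sum_eq_single_of_mem n (Finset.mem_range.2 hN) fun k _ hk => by
      rw [inner_smul_right, inner_monomialLp_of_ne hσ hk.symm, mul_zero], inner_smul_right]
  funext n
  exact mul_right_cancel₀ (inner_monomialLp_self_ne_zero hσ n)
    ((hcoef b hb n).trans (hcoef a ha.tendsto_sum_nat n).symm)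

/-- The polarized norm identity: a linear isometry preserves inner products, and `segalNorm σ ^ 2`
is the inverse of `segalConst σ`. -/
theorem integral_segal_mul_conj (hσ : 0 < σ) {φ ψ : ℝ → ℂ} (hφ : MemLp φ 2) (hψ : MemLp ψ 2) :
    ∫ z, segal σ φ z * gauss σ z * conj (segal σ ψ z * gauss σ z) =
      segalConst σ * ∫ t, φ t * conj (ψ t) := by
  have h := (segalIsometry hσ).inner_map_map (hψ.toLp ψ) (hφ.toLp φ)
  rw [L2.inner_def, L2.inner_def] at h
  have h1 : ∫ t, inner ℂ (hψ.toLp ψ t) (hφ.toLp φ t) = ∫ t, φ t * conj (ψ t) := by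
    refine integral_congr_ae ?_
    filter_upwards [hφ.coeFn_toLp, hψ.coeFn_toLp] with t h1 h2
    rw [h1, h2, RCLike.inner_apply]
  have h2 : ∫ z, inner ℂ (segalIsometry hσ (hψ.toLp ψ) z) (segalIsometry hσ (hφ.toLp φ) z) =
      ∫ z, ((segalNorm σ ^ 2 : ℝ) : ℂ) *
        (segal σ φ z * gauss σ z * conj (segal σ ψ z * gauss σ z)) := by
    refine integral_congr_ae ?_
    filter_upwards [coeFn_segalIsometry hσ hφ, coeFn_segalIsometry hσ hψ] with z h1 h2
    rw [h1, h2, RCLike.inner_apply]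
    simp only [map_mul, Complex.conj_ofReal]
    push_cast
    ring
  rw [h1, h2, integral_const_mul] at h
  rw [← h, ← mul_assoc, ← Complex.ofReal_mul, segalNorm, inv_pow,
    Real.sq_sqrt (segalConst_pos hσ).le, mul_inv_cancel₀ (segalConst_pos hσ).ne',
    Complex.ofReal_one, one_mul]

end SegalBargmann

namespace BicomplexFW

open ComplexConjugate SegalBargmann

/-! ### Idempotent components -/

/-- The bicomplex number with idempotent components `p` and `q`. -/
noncomputable def pair (p q : ℂ) : Bicomplex := ofC p * ePlus + ofC q * eMinus

/-- `Z ↦ Z⁺` as a ring homomorphism. -/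
noncomputable def plusHom : Bicomplex →+* ℂ where
  toFun := plusC
  map_one' := by simp [plusC, QuadraticAlgebra.re_one, QuadraticAlgebra.im_one]
  map_zero' := by simp [plusC]
  map_add' Z W := by simp [plusC]; ring
  map_mul' Z W := by
    simp [plusC]
    linear_combination (-Z.im * W.im) * Complex.I_sq

/-- `Z ↦ Z⁻` as a ring homomorphism. -/
noncomputable def minusHom : Bicomplex →+* ℂ where
  toFun := minusC
  map_one' := by simp [minusC, QuadraticAlgebra.re_one, QuadraticAlgebra.im_one]
  map_zero' := by simp [minusC]
  map_add' Z W := by simp [minusC]; ring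
  map_mul' Z W := by
    simp [minusC]
    linear_combination (-Z.im * W.im) * Complex.I_sq

theorem plusC_add (Z W : Bicomplex) : plusC (Z + W) = plusC Z + plusC W := map_add plusHom Z W
theorem minusC_add (Z W : Bicomplex) : minusC (Z + W) = minusC Z + minusC W := map_add minusHom Z W
theorem plusC_sub (Z W : Bicomplex) : plusC (Z - W) = plusC Z - plusC W := map_sub plusHom Z W
theorem minusC_sub (Z W : Bicomplex) : minusC (Z - W) = minusC Z - minusC W := map_sub minusHom Z W
theorem plusC_mul (Z W : Bicomplex) : plusC (Z * W) = plusC Z * plusC W := map_mul plusHom Z W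
theorem minusC_mul (Z W : Bicomplex) : minusC (Z * W) = minusC Z * minusC W := map_mul minusHom Z W
theorem plusC_pow (Z : Bicomplex) (n : ℕ) : plusC (Z ^ n) = plusC Z ^ n := map_pow plusHom Z n
theorem minusC_pow (Z : Bicomplex) (n : ℕ) : minusC (Z ^ n) = minusC Z ^ n := map_pow minusHom Z n
theorem plusC_zero : plusC 0 = 0 := map_zero plusHom
theorem minusC_zero : minusC 0 = 0 := map_zero minusHom
theorem plusC_sum (s : Finset ℕ) (f : ℕ → Bicomplex) :
    plusC (∑ k ∈ s, f k) = ∑ k ∈ s, plusC (f k) := map_sum plusHom f s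
theorem minusC_sum (s : Finset ℕ) (f : ℕ → Bicomplex) :
    minusC (∑ k ∈ s, f k) = ∑ k ∈ s, minusC (f k) := map_sum minusHom f s

theorem plusC_ofC (z : ℂ) : plusC (ofC z) = z := by simp [plusC, ofC]
theorem minusC_ofC (z : ℂ) : minusC (ofC z) = z := by simp [minusC, ofC]
theorem plusC_ofR (t : ℝ) : plusC (ofR t) = t := by simp [plusC, ofR]
theorem minusC_ofR (t : ℝ) : minusC (ofR t) = t := by simp [minusC, ofR]

theorem plusC_ePlus : plusC ePlus = 1 := by
  simp only [plusC, ePlus]; linear_combination (-1 / 2 : ℂ) * Complex.I_sq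
theorem minusC_ePlus : minusC ePlus = 0 := by
  simp only [minusC, ePlus]; linear_combination (1 / 2 : ℂ) * Complex.I_sq
theorem plusC_eMinus : plusC eMinus = 0 := by
  simp only [plusC, eMinus]; linear_combination (1 / 2 : ℂ) * Complex.I_sq
theorem minusC_eMinus : minusC eMinus = 1 := by
  simp only [minusC, eMinus]; linear_combination (-1 / 2 : ℂ) * Complex.I_sq

theorem plusC_pair (p q : ℂ) : plusC (pair p q) = p := by
  simp [pair, plusC_add, plusC_mul, plusC_ofC, plusC_ePlus, plusC_eMinus]
theorem minusC_pair (p q : ℂ) : minusC (pair p q) = q := by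
  simp [pair, minusC_add, minusC_mul, minusC_ofC, minusC_ePlus, minusC_eMinus]

theorem pair_plusC_minusC (Z : Bicomplex) : pair (plusC Z) (minusC Z) = Z :=
  (idempotent_decomposition Z).symm

theorem ext_components {Z W : Bicomplex} (h₁ : plusC Z = plusC W) (h₂ : minusC Z = minusC W) :
    Z = W := by
  rw [← pair_plusC_minusC Z, ← pair_plusC_minusC W, h₁, h₂]

theorem plusC_conjStar (Z : Bicomplex) : plusC (conjStar Z) = conj (plusC Z) := by
  simp [plusC, conjStar]
theorem minusC_conjStar (Z : Bicomplex) : minusC (conjStar Z) = conj (minusC Z) := by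
  simp [minusC, conjStar]
theorem plusC_conjDagger (Z : Bicomplex) : plusC (conjDagger Z) = minusC Z := by
  simp [plusC, minusC, conjDagger]
theorem minusC_conjDagger (Z : Bicomplex) : minusC (conjDagger Z) = plusC Z := by
  simp [plusC, minusC, conjDagger, sub_eq_add_neg]
theorem plusC_bexp (Z : Bicomplex) : plusC (bexp Z) = Complex.exp (plusC Z) := plusC_pair _ _
theorem minusC_bexp (Z : Bicomplex) : minusC (bexp Z) = Complex.exp (minusC Z) := minusC_pair _ _

/-- The parallelogram law for `z₁` and `i z₂`. The factor `1/2` is why `gauss` has exponent `σ/4`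
where the weight of `M₀` has `σ/2`. -/
theorem norm_sq_eq_components (Z : Bicomplex) :
    ‖Z‖ ^ 2 = (‖plusC Z‖ ^ 2 + ‖minusC Z‖ ^ 2) / 2 := by
  have h := parallelogram_law_with_norm ℂ Z.re (Complex.I * Z.im)
  rw [norm_mul, Complex.norm_I, one_mul] at h
  rw [norm_sq_eq, plusC, minusC]
  linarith

theorem enorm_sq_eq_components (Z : Bicomplex) :
    ‖Z‖ₑ ^ 2 = 2⁻¹ * (‖plusC Z‖ₑ ^ 2 + ‖minusC Z‖ₑ ^ 2) := by
  rw [← ofReal_norm, ← ofReal_norm, ← ofReal_norm, ← ENNReal.ofReal_pow (norm_nonneg _),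
    ← ENNReal.ofReal_pow (norm_nonneg _), ← ENNReal.ofReal_pow (norm_nonneg _),
    norm_sq_eq_components, div_eq_inv_mul, ENNReal.ofReal_mul (by positivity),
    ENNReal.ofReal_add (by positivity) (by positivity), ENNReal.ofReal_inv_of_pos two_pos,
    ENNReal.ofReal_ofNat]

/-- `Z ↦ Z⁺` as a continuous real linear map. -/
noncomputable def plusCLM : Bicomplex →L[ℝ] ℂ :=
  LinearMap.toContinuousLinearMap
    { toFun := plusC
      map_add' := plusC_add
      map_smul' := fun r Z => by simp [plusC, mul_sub, mul_left_comm] }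

/-- `Z ↦ Z⁻` as a continuous real linear map. -/
noncomputable def minusCLM : Bicomplex →L[ℝ] ℂ :=
  LinearMap.toContinuousLinearMap
    { toFun := minusC
      map_add' := minusC_add
      map_smul' := fun r Z => by simp [minusC, mul_left_comm] }

/-- The idempotent decomposition as a continuous real linear map. -/
noncomputable def pairCLM : ℂ × ℂ →L[ℝ] Bicomplex :=
  LinearMap.toContinuousLinearMap
    { toFun := fun p => pair p.1 p.2
      map_add' := fun p q => ext_components (by simp [plusC_add, plusC_pair])
        (by simp [minusC_add, minusC_pair])
      map_smul' := fun r p => ext_components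
        ((plusC_pair _ _).trans ((congrArg (r • ·) (plusC_pair _ _)).symm.trans
          (plusCLM.map_smul r _).symm))
        ((minusC_pair _ _).trans ((congrArg (r • ·) (minusC_pair _ _)).symm.trans
          (minusCLM.map_smul r _).symm)) }

theorem plusCLM_apply (Z : Bicomplex) : plusCLM Z = plusC Z := rfl
theorem minusCLM_apply (Z : Bicomplex) : minusCLM Z = minusC Z := rfl
theorem pairCLM_apply (p : ℂ × ℂ) : pairCLM p = pair p.1 p.2 := rfl

theorem continuous_plusC : Continuous plusC := plusCLM.continuous
theorem continuous_pair {X : Type*} [TopologicalSpace X] {f g : X → ℂ} (hf : Continuous f)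
    (hg : Continuous g) : Continuous fun x => pair (f x) (g x) :=
  pairCLM.continuous.comp (hf.prodMk hg)

section Integration

variable {α : Type*} [MeasurableSpace α] {m : Measure α}

theorem memLp_iff_components {f : α → Bicomplex} {p : ℝ≥0∞} :
    MemLp f p m ↔ MemLp (fun a => plusC (f a)) p m ∧ MemLp (fun a => minusC (f a)) p m := by
  refine ⟨fun h => ⟨plusCLM.comp_memLp' h, minusCLM.comp_memLp' h⟩, fun h => ?_⟩
  have h₁ := (pairCLM.comp (ContinuousLinearMap.inl ℝ ℂ ℂ)).comp_memLp' h.1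
  have h₂ := (pairCLM.comp (ContinuousLinearMap.inr ℝ ℂ ℂ)).comp_memLp' h.2
  refine (h₁.add h₂).ae_eq (Eventually.of_forall fun a => ?_)
  refine ext_components ?_ ?_
  · simp [pairCLM_apply, plusC_add, plusC_pair]
  · simp [pairCLM_apply, minusC_add, minusC_pair]

theorem integrable_iff_components {f : α → Bicomplex} :
    Integrable f m ↔ Integrable (fun a => plusC (f a)) m ∧
      Integrable (fun a => minusC (f a)) m := by
  simp only [← memLp_one_iff_integrable, memLp_iff_components]

theorem plusC_integral {f : α → Bicomplex} (hf : Integrable f m) :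
    plusC (∫ a, f a ∂m) = ∫ a, plusC (f a) ∂m :=
  (plusCLM.integral_comp_comm hf).symm

theorem minusC_integral {f : α → Bicomplex} (hf : Integrable f m) :
    minusC (∫ a, f a ∂m) = ∫ a, minusC (f a) ∂m :=
  (minusCLM.integral_comp_comm hf).symm

theorem eLpNorm_sq_eq_components {f : α → Bicomplex} (hf : AEStronglyMeasurable f m) :
    eLpNorm f 2 m ^ 2 = 2⁻¹ * (eLpNorm (fun a => plusC (f a)) 2 m ^ 2 +
      eLpNorm (fun a => minusC (f a)) 2 m ^ 2) := by
  simp_rw [eLpNorm_two_sq, enorm_sq_eq_components]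
  rw [lintegral_const_mul' _ _ (by simp), lintegral_add_left']
  exact (continuous_plusC.comp_aestronglyMeasurable hf).enorm.pow_const 2

theorem integral_mul_conjStar {f g : α → Bicomplex} (hf : MemLp f 2 m) (hg : MemLp g 2 m) :
    ∫ a, f a * conjStar (g a) ∂m = pair (∫ a, plusC (f a) * conj (plusC (g a)) ∂m)
      (∫ a, minusC (f a) * conj (minusC (g a)) ∂m) := by
  obtain ⟨hf₁, hf₂⟩ := memLp_iff_components.1 hf
  obtain ⟨hg₁, hg₂⟩ := memLp_iff_components.1 hg
  have hi : Integrable (fun a => f a * conjStar (g a)) m := by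
    refine integrable_iff_components.2 ?_
    simp only [plusC_mul, minusC_mul, plusC_conjStar, minusC_conjStar]
    exact ⟨hf₁.integrable_mul hg₁.star, hf₂.integrable_mul hg₂.star⟩
  refine ext_components ?_ ?_
  · rw [plusC_integral hi, plusC_pair]
    simp only [plusC_mul, plusC_conjStar]
  · rw [minusC_integral hi, minusC_pair]
    simp only [minusC_mul, minusC_conjStar]

end Integration

/-! ### The coordinates of the companion -/

/-- The point `x + ε y` for `z = x + i y`. -/
noncomputable def line (ε z : ℂ) : ℂ := z.re + ε * z.im

/-- A complex square root of `-1` is `±i`, so `x + ε y` is `z` or its conjugate. Isometry, measure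
preservation and surjectivity are all read off from these two cases. -/
theorem line_cases {ε : ℂ} (hε : ε ^ 2 = -1) :
    line ε = id ∨ line ε = Complex.conjLIE := by
  have h : (ε - Complex.I) * (ε + Complex.I) = 0 := by
    linear_combination hε - Complex.I_sq
  rcases mul_eq_zero.1 h with h | h
  · left
    funext z
    rw [line, sub_eq_zero.1 h, mul_comm]
    exact Complex.re_add_im z
  · right
    funext z
    rw [line, eq_neg_of_add_eq_zero_left h]
    apply Complex.ext <;> simp

theorem norm_line {ε : ℂ} (hε : ε ^ 2 = -1) (z : ℂ) : ‖line ε z‖ = ‖z‖ := by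
  rcases line_cases hε with h | h <;> rw [h]
  · rfl
  · exact Complex.conjLIE.norm_map z

theorem measurePreserving_line {ε : ℂ} (hε : ε ^ 2 = -1) : MeasurePreserving (line ε) := by
  rcases line_cases hε with h | h <;> rw [h]
  · exact MeasurePreserving.id _
  · exact Complex.conjLIE.measurePreserving

theorem line_surjective {ε : ℂ} (hε : ε ^ 2 = -1) : Function.Surjective (line ε) := by
  rcases line_cases hε with h | h <;> rw [h]
  · exact Function.surjective_id
  · exact Complex.conjLIE.surjective

theorem continuous_line (ε : ℂ) : Continuous (line ε) := by
  unfold line; fun_prop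

theorem plusC_sq {ν : Bicomplex} (hν : ν ^ 2 = -1) : plusC ν ^ 2 = -1 := by
  rw [← plusC_pow, hν]
  exact (map_neg plusHom 1).trans (congrArg _ (map_one plusHom))

theorem minusC_sq {ν : Bicomplex} (hν : ν ^ 2 = -1) : minusC ν ^ 2 = -1 := by
  rw [← minusC_pow, hν]
  exact (map_neg minusHom 1).trans (congrArg _ (map_one minusHom))

theorem plusC_companion (ν μ Z : Bicomplex) :
    plusC (companion ν μ Z) = line (plusC ν) Z.re := by
  simp [companion, zNu, plusC_add, plusC_mul, plusC_ofR, plusC_ePlus, plusC_eMinus, line]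

theorem minusC_companion (ν μ Z : Bicomplex) :
    minusC (companion ν μ Z) = line (minusC μ) Z.im := by
  simp [companion, zMu, minusC_add, minusC_mul, minusC_ofR, minusC_ePlus, minusC_eMinus, line]

theorem continuous_re : Continuous fun Z : Bicomplex => Z.re :=
  (LinearMap.toContinuousLinearMap
    { toFun := fun Z : Bicomplex => Z.re
      map_add' := fun _ _ => rfl
      map_smul' := fun _ _ => rfl } : Bicomplex →L[ℝ] ℂ).continuous

theorem continuous_im : Continuous fun Z : Bicomplex => Z.im :=
  (LinearMap.toContinuousLinearMap
    { toFun := fun Z : Bicomplex => Z.im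
      map_add' := fun _ _ => rfl
      map_smul' := fun _ _ => rfl } : Bicomplex →L[ℝ] ℂ).continuous

theorem continuous_mk : Continuous fun p : ℂ × ℂ => (⟨p.1, p.2⟩ : Bicomplex) :=
  (LinearMap.toContinuousLinearMap
    { toFun := fun p : ℂ × ℂ => (⟨p.1, p.2⟩ : Bicomplex)
      map_add' := fun _ _ => rfl
      map_smul' := fun _ _ => rfl } : ℂ × ℂ →L[ℝ] Bicomplex).continuous

/-- The idempotent components of the companion of `Z`. -/
noncomputable def coords (ν μ Z : Bicomplex) : ℂ × ℂ :=
  (line (plusC ν) Z.re, line (minusC μ) Z.im)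

theorem continuous_coords (ν μ : Bicomplex) : Continuous (coords ν μ) :=
  ((continuous_line _).comp continuous_re).prodMk ((continuous_line _).comp continuous_im)

theorem measurePreserving_coords {ν μ : Bicomplex} (hν : ν ^ 2 = -1) (hμ : μ ^ 2 = -1) :
    MeasurePreserving (coords ν μ) bcMeasure ((4 : ℝ≥0∞)⁻¹ • volume) := by
  refine ⟨(continuous_coords ν μ).measurable, ?_⟩
  rw [bcMeasure, Measure.map_smul, Measure.map_map (continuous_coords ν μ).measurable
    continuous_mk.measurable]
  congr 1
  exact ((measurePreserving_line (plusC_sq hν)).prod (measurePreserving_line (minusC_sq hμ))).map_eq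

/-! ### Functions with separated variables -/

/-- The function `u(z) g(w) e₊ + v(w) g(z) e₋`, where `z`, `w` are the components of the companion
and `g` is the square root of the Gaussian weight. -/
noncomputable def separated (σ : ℝ) (ν μ : Bicomplex) (u v : ℂ → ℂ) (Z : Bicomplex) : Bicomplex :=
  pair (u (coords ν μ Z).1 * gauss σ (coords ν μ Z).2)
    (v (coords ν μ Z).2 * gauss σ (coords ν μ Z).1)

variable {σ : ℝ} {ν μ : Bicomplex} {u v u' v' : ℂ → ℂ}

theorem continuous_separated (hu : Continuous u) (hv : Continuous v) :
    Continuous (separated σ ν μ u v) := by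
  have hc := continuous_coords ν μ
  have hg := continuous_gauss_ofReal σ
  exact continuous_pair ((hu.comp hc.fst).mul (hg.comp hc.snd))
    ((hv.comp hc.snd).mul (hg.comp hc.fst))

theorem lintegral_gauss_sq (hσ : 0 < σ) :
    ∫⁻ z, ‖(gauss σ z : ℂ)‖ₑ ^ 2 = ENNReal.ofReal (2 * Real.pi / σ) := by
  have h : ∫ z : ℂ, Real.exp (-(σ / 2) * ‖z‖ ^ 2) = 2 * Real.pi / σ := by
    simpa using integral_norm_pow_mul_gauss_sq hσ 0
  rw [← h, ofReal_integral_eq_lintegral_ofReal (integrable_exp_neg_mul_sq_norm (by positivity))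
    (Eventually.of_forall fun z => (Real.exp_pos _).le)]
  refine lintegral_congr fun z => ?_
  rw [← enorm_pow, gauss_sq, ← ofReal_norm, Complex.norm_real, Real.norm_eq_abs, Real.abs_exp]

/-- Tonelli in the two coordinates. The constant is `1/4` from `dλ`, `1/2` from the norm in
components, and `2π/σ` from the Gaussian in the other variable. -/
theorem eLpNorm_separated_sq (hσ : 0 < σ) (hν : ν ^ 2 = -1) (hμ : μ ^ 2 = -1)
    (hu : Continuous u) (hv : Continuous v) :
    eLpNorm (separated σ ν μ u v) 2 bcMeasure ^ 2 = ENNReal.ofReal (Real.pi / (4 * σ)) *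
      (eLpNorm u 2 volume ^ 2 + eLpNorm v 2 volume ^ 2) := by
  have hg := continuous_gauss_ofReal σ
  have hum : Measurable fun z => ‖u z‖ₑ ^ 2 := hu.measurable.enorm.pow_const 2
  have hvm : Measurable fun z => ‖v z‖ₑ ^ 2 := hv.measurable.enorm.pow_const 2
  have hgm : Measurable fun z => ‖(gauss σ z : ℂ)‖ₑ ^ 2 := hg.measurable.enorm.pow_const 2
  have hmeas : Measurable fun p : ℂ × ℂ => 2⁻¹ * (‖u p.1‖ₑ ^ 2 * ‖(gauss σ p.2 : ℂ)‖ₑ ^ 2 +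
      ‖(gauss σ p.1 : ℂ)‖ₑ ^ 2 * ‖v p.2‖ₑ ^ 2) :=
    (((hum.comp measurable_fst).mul (hgm.comp measurable_snd)).add
      ((hgm.comp measurable_fst).mul (hvm.comp measurable_snd))).const_mul _
  have h1 : ∀ Z, ‖separated σ ν μ u v Z‖ₑ ^ 2 = (fun p : ℂ × ℂ =>
      2⁻¹ * (‖u p.1‖ₑ ^ 2 * ‖(gauss σ p.2 : ℂ)‖ₑ ^ 2 +
        ‖(gauss σ p.1 : ℂ)‖ₑ ^ 2 * ‖v p.2‖ₑ ^ 2)) (coords ν μ Z) := fun Z => by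
    rw [enorm_sq_eq_components, separated, plusC_pair, minusC_pair]
    simp only [enorm_mul, mul_pow, mul_comm (‖v _‖ₑ ^ 2)]
  rw [eLpNorm_two_sq, lintegral_congr h1,
    (measurePreserving_coords hν hμ).lintegral_comp hmeas, lintegral_smul_measure,
    lintegral_const_mul' _ _ (by simp),
    lintegral_add_left (f := fun p : ℂ × ℂ => ‖u p.1‖ₑ ^ 2 * ‖(gauss σ p.2 : ℂ)‖ₑ ^ 2)
      ((hum.comp measurable_fst).mul (hgm.comp measurable_snd)),
    Measure.volume_eq_prod, lintegral_prod_mul hum.aemeasurable hgm.aemeasurable,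
    lintegral_prod_mul hgm.aemeasurable hvm.aemeasurable, lintegral_gauss_sq hσ,
    eLpNorm_two_sq, eLpNorm_two_sq, mul_comm _ (ENNReal.ofReal _), ← mul_add, smul_eq_mul,
    ← mul_assoc, ← mul_assoc]
  congr 1
  rw [← ENNReal.ofReal_ofNat 4, ← ENNReal.ofReal_ofNat 2, ← ENNReal.ofReal_inv_of_pos (by norm_num),
    ← ENNReal.ofReal_inv_of_pos (by norm_num), ← ENNReal.ofReal_mul (by norm_num),
    ← ENNReal.ofReal_mul (by norm_num)]
  congr 1
  field_simp

theorem memLp_separated (hσ : 0 < σ) (hν : ν ^ 2 = -1) (hμ : μ ^ 2 = -1)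
    (hu : Continuous u) (hv : Continuous v) (hu2 : MemLp u 2) (hv2 : MemLp v 2) :
    MemLp (separated σ ν μ u v) 2 bcMeasure := by
  refine ⟨(continuous_separated hu hv).aestronglyMeasurable, ?_⟩
  have h : eLpNorm (separated σ ν μ u v) 2 bcMeasure ^ 2 < ∞ := by
    rw [eLpNorm_separated_sq hσ hν hμ hu hv]
    exact ENNReal.mul_lt_top ENNReal.ofReal_lt_top
      (ENNReal.add_lt_top.2 ⟨ENNReal.pow_lt_top hu2.2, ENNReal.pow_lt_top hv2.2⟩)
  exact (ENNReal.pow_lt_top_iff.1 h).resolve_right two_ne_zero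

theorem integral_comp_coords (hν : ν ^ 2 = -1) (hμ : μ ^ 2 = -1) {f : ℂ × ℂ → ℂ}
    (hf : Continuous f) :
    ∫ Z, f (coords ν μ Z) ∂bcMeasure = (1 / 4 : ℂ) * ∫ p, f p := by
  rw [← integral_map (φ := coords ν μ) (continuous_coords ν μ).aemeasurable
    hf.aestronglyMeasurable, (measurePreserving_coords hν hμ).map_eq, integral_smul_measure]
  simp

/-- The constant is twice that of the norm identity: the scalar product acts component by component,
without the averaging factor `1/2`. -/
theorem bcInner_separated (hσ : 0 < σ) (hν : ν ^ 2 = -1) (hμ : μ ^ 2 = -1)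
    (hu : Continuous u) (hv : Continuous v) (hu2 : MemLp u 2) (hv2 : MemLp v 2)
    (hu' : Continuous u') (hv' : Continuous v') (hu2' : MemLp u' 2) (hv2' : MemLp v' 2) :
    bcInner bcMeasure (separated σ ν μ u v) (separated σ ν μ u' v') =
      pair ((Real.pi / (2 * σ) : ℝ) * ∫ z, u z * conj (u' z))
        ((Real.pi / (2 * σ) : ℝ) * ∫ z, v z * conj (v' z)) := by
  have hg := continuous_gauss_ofReal σ
  rw [bcInner, integral_mul_conjStar (memLp_separated hσ hν hμ hu hv hu2 hv2)
    (memLp_separated hσ hν hμ hu' hv' hu2' hv2')]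
  have hconst : ((1 / 4 : ℂ)) * (2 * Real.pi / σ : ℝ) = (Real.pi / (2 * σ) : ℝ) := by
    push_cast
    field_simp
    norm_num
  congr 1
  · have h1 : ∀ Z, plusC (separated σ ν μ u v Z) * conj (plusC (separated σ ν μ u' v' Z)) =
        (fun p : ℂ × ℂ => (u p.1 * conj (u' p.1)) * (gauss σ p.2 : ℂ) ^ 2) (coords ν μ Z) := by
      intro Z
      simp only [separated, plusC_pair, map_mul, Complex.conj_ofReal]
      ring
    have hc : Continuous fun p : ℂ × ℂ => (u p.1 * conj (u' p.1)) * (gauss σ p.2 : ℂ) ^ 2 :=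
      ((hu.comp continuous_fst).mul (Complex.continuous_conj.comp
        (hu'.comp continuous_fst))).mul ((hg.comp continuous_snd).pow 2)
    refine (integral_congr_ae (Eventually.of_forall h1)).trans
      ((integral_comp_coords hν hμ hc).trans ?_)
    rw [Measure.volume_eq_prod,
      integral_prod_mul (fun z => u z * conj (u' z)) fun z => (gauss σ z : ℂ) ^ 2,
      integral_gauss_sq hσ, mul_left_comm, hconst, mul_comm]
  · have h1 : ∀ Z, minusC (separated σ ν μ u v Z) * conj (minusC (separated σ ν μ u' v' Z)) =
        (fun p : ℂ × ℂ => (gauss σ p.1 : ℂ) ^ 2 * (v p.2 * conj (v' p.2))) (coords ν μ Z) := by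
      intro Z
      simp only [separated, minusC_pair, map_mul, Complex.conj_ofReal]
      ring
    have hc : Continuous fun p : ℂ × ℂ => (gauss σ p.1 : ℂ) ^ 2 * (v p.2 * conj (v' p.2)) :=
      ((hg.comp continuous_fst).pow 2).mul ((hv.comp continuous_snd).mul
        (Complex.continuous_conj.comp (hv'.comp continuous_snd)))
    refine (integral_congr_ae (Eventually.of_forall h1)).trans
      ((integral_comp_coords hν hμ hc).trans ?_)
    rw [Measure.volume_eq_prod,
      integral_prod_mul (fun z => (gauss σ z : ℂ) ^ 2) fun z => v z * conj (v' z),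
      integral_gauss_sq hσ, ← mul_assoc, hconst]

/-! ### The companion Bargmann space -/

theorem plusC_zNu (ν Z : Bicomplex) : plusC (zNu ν Z) = line (plusC ν) Z.re := by
  simp [zNu, plusC_add, plusC_mul, plusC_ofR, line]

theorem minusC_zMu (μ Z : Bicomplex) : minusC (zMu μ Z) = line (minusC μ) Z.im := by
  simp [zMu, minusC_add, minusC_mul, minusC_ofR, line]

theorem ofReal_exp_norm_companion (σ : ℝ) (ν μ Z : Bicomplex) :
    ((Real.exp (-(σ / 2) * ‖companion ν μ Z‖ ^ 2) : ℝ) : ℂ) =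
      gauss σ (coords ν μ Z).1 * gauss σ (coords ν μ Z).2 := by
  rw [norm_sq_eq_components, plusC_companion, minusC_companion, gauss, gauss, ← Complex.ofReal_mul,
    ← Real.exp_add, coords]
  congr 2
  ring

/-- The density `e^{-(σ/2)(x² + y²)}` is the square of `gauss`, and passing from `x + i y` to `x + ε
y` preserves both measure and modulus. -/
theorem memWeightedL2_iff {τ : Bicomplex} {ε : ℂ} (hε : ε ^ 2 = -1) {F : Bicomplex → ℂ} {f : ℂ → ℂ}
    (hf : Continuous f) (h : ∀ z : ℂ, F (ofR z.re + τ * ofR z.im) = f (line ε z)) :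
    MemWeightedL2 (σ / 2) τ F ↔ MemLp (fun z => f z * gauss σ z) 2 := by
  have hFf : (fun p : ℝ × ℝ => F (ofR p.1 + τ * ofR p.2)) =
      fun p : ℝ × ℝ => f (line ε (p.1 + p.2 * Complex.I)) := by
    funext p
    rw [← h]
    simp
  have hc : Continuous fun p : ℝ × ℝ => f (line ε (p.1 + p.2 * Complex.I)) :=
    hf.comp ((continuous_line ε).comp (by fun_prop))
  have hm : Continuous fun z => f z * gauss σ z := hf.mul (continuous_gauss_ofReal σ)
  have hnorm : eLpNorm (fun p : ℝ × ℝ => f (line ε (p.1 + p.2 * Complex.I))) 2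
      (volume.withDensity fun p : ℝ × ℝ =>
        ENNReal.ofReal (Real.exp (-(σ / 2) * (p.1 ^ 2 + p.2 ^ 2)))) ^ 2 =
      eLpNorm (fun z => f z * gauss σ z) 2 volume ^ 2 := by
    have hmeas : Measurable fun z => ‖f z * gauss σ z‖ₑ ^ 2 := hm.measurable.enorm.pow_const 2
    have hmeas' : Measurable fun z => ‖f (line ε z) * gauss σ (line ε z)‖ₑ ^ 2 :=
      hmeas.comp (continuous_line ε).measurable
    rw [eLpNorm_two_sq, eLpNorm_two_sq, lintegral_withDensity_eq_lintegral_mul _ (by fun_prop)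
      (hc.measurable.enorm.pow_const 2), ← (measurePreserving_line hε).lintegral_comp hmeas,
      ← Complex.volume_preserving_equiv_real_prod.symm.lintegral_comp hmeas']
    refine lintegral_congr fun p => ?_
    have hp : Complex.measurableEquivRealProd.symm p = p.1 + p.2 * Complex.I := by
      rw [Complex.measurableEquivRealProd_symm_apply, Complex.mk_eq_add_mul_I]
    simp only [Pi.mul_apply, hp]
    rw [enorm_mul, mul_pow, mul_comm]
    congr 1
    rw [← enorm_pow, gauss_sq, ← ofReal_norm, Complex.norm_real, Real.norm_eq_abs, Real.abs_exp,
      norm_line hε, ← Complex.normSq_eq_norm_sq, Complex.normSq_add_mul_I]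
  rw [MemWeightedL2, hFf]
  have hlt : ∀ a : ℝ≥0∞, a < ∞ ↔ a ^ 2 < ∞ := fun a => by
    simp [ENNReal.pow_lt_top_iff]
  simp only [MemLp, hc.aestronglyMeasurable, hm.aestronglyMeasurable, true_and]
  rw [hlt, hnorm, ← hlt]

theorem fderiv_comp_pair_left {fe : Bicomplex → Bicomplex} (hfe : Differentiable ℝ fe) (q z h : ℂ) :
    fderiv ℝ (fun z => plusC (fe (pair z q))) z h = plusC (fderiv ℝ fe (pair z q) (pair h 0)) := by
  have h1 : HasFDerivAt (fun z : ℂ => pairCLM (z, q))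
      (pairCLM.comp (ContinuousLinearMap.inl ℝ ℂ ℂ)) z :=
    pairCLM.hasFDerivAt.comp z (hasFDerivAt_prodMk_left z q)
  have h2 := plusCLM.hasFDerivAt.comp z ((hfe (pair z q)).hasFDerivAt.comp z h1)
  exact congrArg (fun L => L h) h2.fderiv

theorem fderiv_comp_pair_right {fe : Bicomplex → Bicomplex} (hfe : Differentiable ℝ fe)
    (p w h : ℂ) :
    fderiv ℝ (fun w => minusC (fe (pair p w))) w h =
      minusC (fderiv ℝ fe (pair p w) (pair 0 h)) := by
  have h1 : HasFDerivAt (fun w : ℂ => pairCLM (p, w))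
      (pairCLM.comp (ContinuousLinearMap.inr ℝ ℂ ℂ)) w :=
    pairCLM.hasFDerivAt.comp w (hasFDerivAt_prodMk_right p w)
  have h2 := minusCLM.hasFDerivAt.comp w ((hfe (pair p w)).hasFDerivAt.comp w h1)
  exact congrArg (fun L => L h) h2.fderiv

/-- The equation is unchanged under `ε ↦ -ε`, so either choice of root gives the usual
Cauchy--Riemann equation. Conjugating a coordinate therefore never produces antiholomorphic
functions. -/
theorem differentiableAt_complex_of_cauchyRiemann {f : ℂ → ℂ} {z ε : ℂ} (hε : ε ^ 2 = -1)
    (hf : DifferentiableAt ℝ f z) (h : fderiv ℝ f z 1 + ε * fderiv ℝ f z ε = 0) :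
    DifferentiableAt ℂ f z := by
  rw [differentiableAt_complex_iff_differentiableAt_real]
  refine ⟨hf, ?_⟩
  have hcr : fderiv ℝ f z ε = ε * fderiv ℝ f z 1 := by
    linear_combination (-ε) * h + fderiv ℝ f z ε * hε
  have hcases : (ε - Complex.I) * (ε + Complex.I) = 0 := by
    linear_combination hε - Complex.I_sq
  rcases mul_eq_zero.1 hcases with h | h
  · rw [sub_eq_zero.1 h] at hcr
    rw [hcr, smul_eq_mul]
  · rw [eq_neg_of_add_eq_zero_left h, map_neg] at hcr
    rw [smul_eq_mul]
    linear_combination -hcr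

theorem ePlus_eq_pair : ePlus = pair 1 0 :=
  ext_components (by rw [plusC_pair, plusC_ePlus]) (by rw [minusC_pair, minusC_ePlus])

theorem eMinus_eq_pair : eMinus = pair 0 1 :=
  ext_components (by rw [plusC_pair, plusC_eMinus]) (by rw [minusC_pair, minusC_eMinus])

theorem mul_ePlus (τ : Bicomplex) : τ * ePlus = pair (plusC τ) 0 :=
  ext_components (by simp [plusC_pair, plusC_mul, plusC_ePlus])
    (by simp [minusC_pair, minusC_mul, minusC_ePlus])

theorem mul_eMinus (τ : Bicomplex) : τ * eMinus = pair 0 (minusC τ) :=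
  ext_components (by simp [plusC_pair, plusC_mul, plusC_eMinus])
    (by simp [minusC_pair, minusC_mul, minusC_eMinus])

/-- The `e₊` part of the second equation of `IsHolo` is the Cauchy--Riemann equation of the plus
component in its own variable. -/
theorem IsHolo.differentiable_plusC (hν : ν ^ 2 = -1) {fe : Bicomplex → Bicomplex}
    (h : IsHolo ν μ fe) (q : ℂ) : Differentiable ℂ fun z => plusC (fe (pair z q)) := by
  intro z
  have hd : Differentiable ℝ fun z => plusC (fe (pair z q)) :=
    plusCLM.differentiable.comp (h.1.comp (pairCLM.differentiable.comp
      (differentiable_id.prodMk (differentiable_const q))))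
  refine differentiableAt_complex_of_cauchyRiemann (plusC_sq hν) (hd z) ?_
  have h2 := congrArg plusC (h.2 (pair z q)).2.1
  simp only [dBar, plusC_add, plusC_mul, plusC_ofR, plusC_eMinus, plusC_zero, plusC_pair,
    mul_ePlus, mul_zero, add_zero] at h2
  rw [fderiv_comp_pair_left h.1, fderiv_comp_pair_left h.1, ← ePlus_eq_pair]
  simpa using h2

theorem IsHolo.differentiable_minusC (hμ : μ ^ 2 = -1) {fe : Bicomplex → Bicomplex}
    (h : IsHolo ν μ fe) (p : ℂ) : Differentiable ℂ fun w => minusC (fe (pair p w)) := by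
  intro w
  have hd : Differentiable ℝ fun w => minusC (fe (pair p w)) :=
    minusCLM.differentiable.comp (h.1.comp (pairCLM.differentiable.comp
      ((differentiable_const p).prodMk differentiable_id)))
  refine differentiableAt_complex_of_cauchyRiemann (minusC_sq hμ) (hd w) ?_
  have h2 := congrArg minusC (h.2 (pair p w)).2.1
  simp only [dBar, minusC_add, minusC_mul, minusC_ofR, minusC_ePlus, minusC_zero, minusC_pair,
    mul_eMinus, mul_zero, zero_add] at h2
  rw [fderiv_comp_pair_right h.1, fderiv_comp_pair_right h.1, ← eMinus_eq_pair]
  simpa using h2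

/-- The first and third equations differentiate each component in the variable on which it does not
depend; the second is the Cauchy--Riemann equation of `F` and of `G`. -/
theorem isHolo_pair (hν : ν ^ 2 = -1) (hμ : μ ^ 2 = -1) {F G : ℂ → ℂ} (hF : Differentiable ℂ F)
    (hG : Differentiable ℂ G) :
    IsHolo ν μ fun W => pair (F (plusC W)) (G (minusC W)) := by
  have hder : ∀ W, HasFDerivAt (fun W => pair (F (plusC W)) (G (minusC W)))
      (pairCLM.comp ((((fderiv ℂ F (plusC W)).restrictScalars ℝ).comp plusCLM).prod
        (((fderiv ℂ G (minusC W)).restrictScalars ℝ).comp minusCLM))) W := fun W =>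
    pairCLM.hasFDerivAt.comp W
      ((((hF (plusC W)).hasFDerivAt.restrictScalars ℝ).comp W plusCLM.hasFDerivAt).prodMk
        (((hG (minusC W)).hasFDerivAt.restrictScalars ℝ).comp W minusCLM.hasFDerivAt))
  have happ : ∀ W p q, fderiv ℝ (fun W => pair (F (plusC W)) (G (minusC W))) W (pair p q) =
      pair (deriv F (plusC W) * p) (deriv G (minusC W) * q) := fun W p q => by
    rw [(hder W).fderiv]
    simp [pairCLM_apply, plusCLM_apply, minusCLM_apply, plusC_pair, minusC_pair, mul_comm]
  refine ⟨fun W => (hder W).differentiableAt, fun W => ?_⟩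
  have hν' := plusC_sq hν
  have hμ' := minusC_sq hμ
  simp only [dBar, dHol, mul_ePlus, mul_eMinus]
  simp only [ePlus_eq_pair, eMinus_eq_pair, happ]
  refine ⟨ext_components ?_ ?_, ext_components ?_ ?_, ext_components ?_ ?_⟩ <;>
  simp only [plusC_add, plusC_sub, plusC_mul, plusC_pair, plusC_zero, plusC_ofR, minusC_add,
    minusC_sub, minusC_mul, minusC_pair, minusC_zero, minusC_ofR]
  · ring
  · ring
  · push_cast
    linear_combination (deriv F (plusC W) / 2) * hν'
  · push_cast
    linear_combination (deriv G (minusC W) / 2) * hμ'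
  · ring
  · ring

/-- Reduces `M₀` to pairs of entire functions of one complex variable. The separated form makes each
component depend on one coordinate only, so `F` and `G` are found by freezing the other coordinate
at `0`. -/
theorem mem_M0_iff (hν : ν ^ 2 = -1) (hμ : μ ^ 2 = -1) {U : Bicomplex → Bicomplex} :
    U ∈ M0 σ ν μ ↔ ∃ F G : ℂ → ℂ, Differentiable ℂ F ∧ Differentiable ℂ G ∧
      MemLp (fun z => F z * gauss σ z) 2 ∧ MemLp (fun z => G z * gauss σ z) 2 ∧
      U = separated σ ν μ (fun z => F z * gauss σ z) fun z => G z * gauss σ z := by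
  constructor
  · rintro ⟨f, ⟨⟨fe, hfe, hholo⟩, F₀, G₀, hf, hF₀, hG₀⟩, hU⟩
    have hplus : ∀ Z, plusC (fe (companion ν μ Z)) = F₀ (zNu ν Z) := fun Z => by
      rw [← hfe, hf]
      exact plusC_pair _ _
    have hminus : ∀ Z, minusC (fe (companion ν μ Z)) = G₀ (zMu μ Z) := fun Z => by
      rw [← hfe, hf]
      exact minusC_pair _ _
    have hF : ∀ z w : ℂ, F₀ (zNu ν ⟨z, w⟩) = plusC (fe (pair (line (plusC ν) z) 0)) :=
      fun z w => by
        -- The plus component does not see the second coordinate, so `w` may be replaced by a point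
        -- whose companion coordinate is `0`.
        obtain ⟨w', hw'⟩ := line_surjective (minusC_sq hμ) 0
        have : companion ν μ ⟨z, w'⟩ = pair (line (plusC ν) z) 0 :=
          ext_components (by rw [plusC_companion, plusC_pair])
            (by rw [minusC_companion, minusC_pair, hw'])
        rw [← this, hplus]
        rfl
    have hG : ∀ z w : ℂ, G₀ (zMu μ ⟨z, w⟩) = minusC (fe (pair 0 (line (minusC μ) w))) :=
      fun z w => by
        obtain ⟨z', hz'⟩ := line_surjective (plusC_sq hν) 0
        have : companion ν μ ⟨z', w⟩ = pair 0 (line (minusC μ) w) :=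
          ext_components (by rw [plusC_companion, plusC_pair, hz'])
            (by rw [minusC_companion, minusC_pair])
        rw [← this, hminus]
        rfl
    have hFd := hholo.differentiable_plusC hν 0
    have hGd := hholo.differentiable_minusC hμ 0
    refine ⟨_, _, hFd, hGd, (memWeightedL2_iff (plusC_sq hν) hFd.continuous fun z => hF z 0).1 hF₀,
      (memWeightedL2_iff (minusC_sq hμ) hGd.continuous fun z => hG 0 z).1 hG₀, ?_⟩
    funext ⟨z, w⟩
    refine ext_components ?_ ?_
    · rw [hU, hfe, plusC_mul, plusC_ofR, hplus, hF, ofReal_exp_norm_companion, separated,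
        plusC_pair, coords]
      ring
    · rw [hU, hfe, minusC_mul, minusC_ofR, hminus, hG, ofReal_exp_norm_companion, separated,
        minusC_pair, coords]
      ring
  · rintro ⟨F, G, hF, hG, hF2, hG2, rfl⟩
    refine ⟨fun Z => pair (F (plusC (companion ν μ Z))) (G (minusC (companion ν μ Z))),
      ⟨⟨_, fun Z => rfl, isHolo_pair hν hμ hF hG⟩, fun W => F (plusC W), fun W => G (minusC W),
        fun Z => ?_, ?_, ?_⟩, fun Z => ?_⟩
    · change _ = pair (F (plusC (zNu ν Z))) (G (minusC (zMu μ Z)))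
      simp only [plusC_companion, minusC_companion, plusC_zNu, minusC_zMu]
    · refine (memWeightedL2_iff (plusC_sq hν) hF.continuous fun z => ?_).2 hF2
      exact congrArg F (plusC_zNu ν ⟨z, 0⟩)
    · refine (memWeightedL2_iff (minusC_sq hμ) hG.continuous fun z => ?_).2 hG2
      exact congrArg G (minusC_zMu μ ⟨0, z⟩)
    · refine ext_components ?_ ?_
      · rw [plusC_mul, plusC_ofR, ofReal_exp_norm_companion, separated, plusC_pair, plusC_pair,
          plusC_companion, coords]
        ring
      · rw [minusC_mul, minusC_ofR, ofReal_exp_norm_companion, separated, minusC_pair, minusC_pair,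
          minusC_companion, coords]
        ring

/-! ### The transform `S₀` -/

theorem plusC_fwIntegrand (φ : ℝ → Bicomplex) (Z : Bicomplex) (t : ℝ) :
    plusC (fwIntegrand σ ν μ φ (gaussWindow σ) Z t) = plusC (φ t) *
      (Complex.exp (σ * plusC ν * (t - 1 / 2 * Z.re.re) * Z.re.im) *
        Complex.exp (-(σ / 2) * (t - Z.re.re) ^ 2)) := by
  simp [fwIntegrand, modulation, translation, gaussWindow, hypX, hypY, plusC_mul, plusC_add,
    plusC_sub, plusC_bexp, plusC_conjStar, plusC_ofR, plusC_ofC, plusC_ePlus, plusC_eMinus,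
    ← Complex.exp_conj, map_ofNat]

theorem minusC_fwIntegrand (φ : ℝ → Bicomplex) (Z : Bicomplex) (t : ℝ) :
    minusC (fwIntegrand σ ν μ φ (gaussWindow σ) Z t) = minusC (φ t) *
      (Complex.exp (σ * minusC μ * (t - 1 / 2 * Z.im.re) * Z.im.im) *
        Complex.exp (-(σ / 2) * (t - Z.im.re) ^ 2)) := by
  simp [fwIntegrand, modulation, translation, gaussWindow, hypX, hypY, minusC_mul, minusC_add,
    minusC_sub, minusC_bexp, minusC_conjStar, minusC_ofR, minusC_ofC, minusC_ePlus, minusC_eMinus,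
    ← Complex.exp_conj, map_ofNat]

/-- The identity behind the whole reduction: modulation times shifted window is the Segal--Bargmann
kernel at `x + ε y` times the Gaussian. Only `ε² = -1` enters. -/
theorem segalKernel_line_mul_gauss {ε : ℂ} (hε : ε ^ 2 = -1) (z : ℂ) (t : ℝ) :
    Complex.exp (σ * ε * (t - 1 / 2 * z.re) * z.im) *
        Complex.exp (-(σ / 2) * (t - z.re) ^ 2) =
      segalKernel σ (line ε z) t * gauss σ (line ε z) := by
  have h : (‖line ε z‖ : ℝ) ^ 2 = z.re ^ 2 + z.im ^ 2 := by
    rw [norm_line hε, ← Complex.normSq_eq_norm_sq, Complex.normSq_apply]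
    ring
  rw [segalKernel, gauss, h, Complex.ofReal_exp, ← Complex.exp_add, ← Complex.exp_add, line]
  congr 1
  push_cast
  linear_combination (σ / 4 * (z.im : ℂ) ^ 2) * hε

theorem plusC_fwIntegrand_eq (hν : ν ^ 2 = -1) (φ : ℝ → Bicomplex) (Z : Bicomplex) (t : ℝ) :
    plusC (fwIntegrand σ ν μ φ (gaussWindow σ) Z t) =
      plusC (φ t) * segalKernel σ (coords ν μ Z).1 t * gauss σ (coords ν μ Z).1 := by
  rw [plusC_fwIntegrand, segalKernel_line_mul_gauss (plusC_sq hν), mul_assoc]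
  rfl

theorem minusC_fwIntegrand_eq (hμ : μ ^ 2 = -1) (φ : ℝ → Bicomplex) (Z : Bicomplex) (t : ℝ) :
    minusC (fwIntegrand σ ν μ φ (gaussWindow σ) Z t) =
      minusC (φ t) * segalKernel σ (coords ν μ Z).2 t * gauss σ (coords ν μ Z).2 := by
  rw [minusC_fwIntegrand, segalKernel_line_mul_gauss (minusC_sq hμ), mul_assoc]
  rfl

theorem integrable_fwIntegrand (hσ : 0 < σ) (hν : ν ^ 2 = -1) (hμ : μ ^ 2 = -1)
    {φ : ℝ → Bicomplex} (hφ : MemLp φ 2) (Z : Bicomplex) :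
    Integrable (fwIntegrand σ ν μ φ (gaussWindow σ) Z) := by
  obtain ⟨h₁, h₂⟩ := memLp_iff_components.1 hφ
  refine integrable_iff_components.2 ⟨?_, ?_⟩
  · simp_rw [plusC_fwIntegrand_eq hν]
    exact (integrable_mul_segalKernel hσ h₁ _).mul_const _
  · simp_rw [minusC_fwIntegrand_eq hμ]
    exact (integrable_mul_segalKernel hσ h₂ _).mul_const _

/-- The factor that relates `S₀` to the Segal--Bargmann transform of the components. -/
noncomputable def s0Const (σ : ℝ) : ℝ := (σ / Real.pi) ^ (1 / 4 : ℝ) * (σ / Real.pi)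

theorem s0Const_pos (hσ : 0 < σ) : 0 < s0Const σ := by
  unfold s0Const; positivity

theorem s0Const_sq_mul (hσ : 0 < σ) :
    s0Const σ ^ 2 * segalConst σ * (Real.pi / (2 * σ)) = 1 := by
  have h1 : ((σ / Real.pi) ^ (1 / 4 : ℝ)) ^ 2 = √(σ / Real.pi) := by
    rw [← Real.rpow_natCast, ← Real.rpow_mul (by positivity), Real.sqrt_eq_rpow]
    norm_num
  have h2 : √(σ / Real.pi) * √(Real.pi / σ) = 1 := by
    rw [← Real.sqrt_mul (by positivity)]
    field_simp
    simp
  rw [s0Const, segalConst, mul_pow, h1]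
  calc _ = (√(σ / Real.pi) * √(Real.pi / σ)) *
        ((σ / Real.pi) ^ 2 * (2 * Real.pi / σ) * (Real.pi / (2 * σ))) := by ring
    _ = 1 := by
      rw [h2]
      field_simp

/-- The kernel identity yields the Gaussian in each component's own variable. The prefactor contains
`X_e†` and `Y_e†`, whose components are exchanged, and so yields the Gaussian in the other variable.
-/
theorem S0_eq_separated (hσ : 0 < σ) (hν : ν ^ 2 = -1) (hμ : μ ^ 2 = -1)
    {φ : ℝ → Bicomplex} (hφ : MemLp φ 2) :
    S0 σ ν μ φ = separated σ ν μ
      (fun z => s0Const σ * segal σ (fun t => plusC (φ t)) z * gauss σ z)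
      fun z => s0Const σ * segal σ (fun t => minusC (φ t)) z * gauss σ z := by
  funext Z
  have hi := integrable_fwIntegrand hσ hν hμ hφ Z
  have hg : ∀ {ε : ℂ}, ε ^ 2 = -1 → ∀ z : ℂ, (gauss σ (line ε z) : ℂ) =
      Complex.exp (-(σ / 4) * ((z.re : ℂ) ^ 2 + (z.im : ℂ) ^ 2)) := fun hε z => by
    rw [gauss, norm_line hε, ← Complex.normSq_eq_norm_sq, Complex.normSq_apply, Complex.ofReal_exp]
    congr 1
    push_cast
    ring
  refine ext_components ?_ ?_
  · rw [S0, fwTransform, plusC_mul, plusC_mul, plusC_mul, plusC_integral hi, plusC_bexp]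
    simp_rw [plusC_fwIntegrand_eq hν]
    rw [integral_mul_const, separated, plusC_pair, coords, hg (minusC_sq hμ)]
    simp only [plusC_mul, plusC_add, plusC_pow, plusC_conjDagger, minusC_add, minusC_mul, hypX,
      hypY, minusC_ofR, plusC_ofR, minusC_ePlus, minusC_eMinus, s0Const, segal]
    push_cast
    ring_nf
  · rw [S0, fwTransform, minusC_mul, minusC_mul, minusC_mul, minusC_integral hi, minusC_bexp]
    simp_rw [minusC_fwIntegrand_eq hμ]
    rw [integral_mul_const, separated, minusC_pair, coords, hg (plusC_sq hν)]
    simp only [minusC_mul, minusC_add, minusC_pow, minusC_conjDagger, plusC_add, plusC_mul, hypX,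
      hypY, plusC_ofR, minusC_ofR, plusC_ePlus, plusC_eMinus, s0Const, segal]
    push_cast
    ring_nf

theorem continuous_s0Const_mul_segal (hσ : 0 < σ) {φ : ℝ → ℂ} (hφ : MemLp φ 2) :
    Continuous fun z => s0Const σ * segal σ φ z * gauss σ z :=
  (continuous_const.mul (differentiable_segal hσ hφ).continuous).mul (continuous_gauss_ofReal σ)

theorem memLp_s0Const_mul_segal (hσ : 0 < σ) {φ : ℝ → ℂ} (hφ : MemLp φ 2) :
    MemLp (fun z => s0Const σ * segal σ φ z * gauss σ z) 2 := by
  simp_rw [mul_assoc]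
  exact (memLp_segal_mul_gauss hσ hφ).const_mul _

theorem eLpNorm_const_mul_sq (r : ℝ) (f : ℂ → ℂ) :
    eLpNorm (fun z => (r : ℂ) * f z) 2 volume ^ 2 =
      ENNReal.ofReal (r ^ 2) * eLpNorm f 2 volume ^ 2 := by
  have h : ‖(r : ℂ)‖ₑ ^ 2 = ENNReal.ofReal (r ^ 2) := by
    rw [← ofReal_norm, ← ENNReal.ofReal_pow (norm_nonneg _), Complex.norm_real, Real.norm_eq_abs,
      sq_abs]
  rw [eLpNorm_two_sq, eLpNorm_two_sq, ← h, ← lintegral_const_mul' _ _ (by simp)]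
  simp_rw [enorm_mul, mul_pow]

/-- By `s0Const_sq_mul` all constants collapse to `1/2`, the factor in the norm of `φ` in
components. -/
theorem eLpNorm_S0 (hσ : 0 < σ) (hν : ν ^ 2 = -1) (hμ : μ ^ 2 = -1)
    {φ : ℝ → Bicomplex} (hφ : MemLp φ 2) :
    eLpNorm (S0 σ ν μ φ) 2 bcMeasure = eLpNorm φ 2 volume := by
  obtain ⟨h₁, h₂⟩ := memLp_iff_components.1 hφ
  refine (ENNReal.pow_right_strictMono two_ne_zero).injective ?_
  have hA : ∀ {f : ℝ → ℂ}, MemLp f 2 →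
      eLpNorm (fun z => s0Const σ * segal σ f z * gauss σ z) 2 volume ^ 2 =
        ENNReal.ofReal (s0Const σ ^ 2 * segalConst σ) * eLpNorm f 2 volume ^ 2 := fun hf => by
    simp_rw [mul_assoc]
    rw [eLpNorm_const_mul_sq, eLpNorm_two_sq, lintegral_enorm_segal_sq hσ hf, ← eLpNorm_two_sq,
      ← mul_assoc, ← ENNReal.ofReal_mul (by positivity)]
  rw [S0_eq_separated hσ hν hμ hφ, eLpNorm_separated_sq hσ hν hμ
    (continuous_s0Const_mul_segal hσ h₁) (continuous_s0Const_mul_segal hσ h₂), hA h₁, hA h₂,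
    eLpNorm_sq_eq_components hφ.1, ← mul_add, ← mul_assoc, ← ENNReal.ofReal_mul (by positivity)]
  congr 1
  rw [← ENNReal.ofReal_ofNat 2, ← ENNReal.ofReal_inv_of_pos two_pos]
  congr 1
  have := s0Const_sq_mul hσ
  calc _ = (s0Const σ ^ 2 * segalConst σ * (Real.pi / (2 * σ))) * 2⁻¹ := by ring
    _ = 2⁻¹ := by rw [this, one_mul]

theorem bcInner_S0 (hσ : 0 < σ) (hν : ν ^ 2 = -1) (hμ : μ ^ 2 = -1)
    {φ ψ : ℝ → Bicomplex} (hφ : MemLp φ 2) (hψ : MemLp ψ 2) :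
    bcInner bcMeasure (S0 σ ν μ φ) (S0 σ ν μ ψ) = bcInner volume φ ψ := by
  obtain ⟨h₁, h₂⟩ := memLp_iff_components.1 hφ
  obtain ⟨k₁, k₂⟩ := memLp_iff_components.1 hψ
  have hA : ∀ {f g : ℝ → ℂ}, MemLp f 2 → MemLp g 2 → (Real.pi / (2 * σ) : ℝ) *
      ∫ z, s0Const σ * segal σ f z * gauss σ z * conj (s0Const σ * segal σ g z * gauss σ z) =
      ∫ t, f t * conj (g t) := fun {f g} hf hg => by
    have : ∀ z, s0Const σ * segal σ f z * gauss σ z *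
        conj (s0Const σ * segal σ g z * gauss σ z) = ((s0Const σ ^ 2 : ℝ) : ℂ) *
          (segal σ f z * gauss σ z * conj (segal σ g z * gauss σ z)) := fun z => by
      simp only [map_mul, Complex.conj_ofReal]
      push_cast
      ring
    simp_rw [this]
    rw [integral_const_mul, integral_segal_mul_conj hσ hf hg, ← mul_assoc, ← mul_assoc,
      ← Complex.ofReal_mul, ← Complex.ofReal_mul,
      show Real.pi / (2 * σ) * s0Const σ ^ 2 * segalConst σ =
        s0Const σ ^ 2 * segalConst σ * (Real.pi / (2 * σ)) by ring, s0Const_sq_mul hσ,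
      Complex.ofReal_one, one_mul]
  rw [S0_eq_separated hσ hν hμ hφ, S0_eq_separated hσ hν hμ hψ, bcInner_separated hσ hν hμ
    (continuous_s0Const_mul_segal hσ h₁) (continuous_s0Const_mul_segal hσ h₂)
    (memLp_s0Const_mul_segal hσ h₁) (memLp_s0Const_mul_segal hσ h₂)
    (continuous_s0Const_mul_segal hσ k₁) (continuous_s0Const_mul_segal hσ k₂)
    (memLp_s0Const_mul_segal hσ k₁) (memLp_s0Const_mul_segal hσ k₂), hA h₁ k₁, hA h₂ k₂, bcInner,
    integral_mul_conjStar hφ hψ]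

theorem memLp_mul_left {φ : ℝ → Bicomplex} (hφ : MemLp φ 2) (c : Bicomplex) :
    MemLp (fun t => c * φ t) 2 := by
  obtain ⟨h₁, h₂⟩ := memLp_iff_components.1 hφ
  refine memLp_iff_components.2 ?_
  simp only [plusC_mul, minusC_mul]
  exact ⟨h₁.const_mul _, h₂.const_mul _⟩

theorem S0_linear (hσ : 0 < σ) (hν : ν ^ 2 = -1) (hμ : μ ^ 2 = -1)
    {φ ψ : ℝ → Bicomplex} (hφ : MemLp φ 2) (hψ : MemLp ψ 2) (c d Z : Bicomplex) :
    S0 σ ν μ (fun t => c * φ t + d * ψ t) Z = c * S0 σ ν μ φ Z + d * S0 σ ν μ ψ Z := by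
  obtain ⟨h₁, h₂⟩ := memLp_iff_components.1 hφ
  obtain ⟨k₁, k₂⟩ := memLp_iff_components.1 hψ
  have hsum : MemLp (fun t => c * φ t + d * ψ t) 2 :=
    (memLp_mul_left hφ c).add (memLp_mul_left hψ d)
  rw [S0_eq_separated hσ hν hμ hφ, S0_eq_separated hσ hν hμ hψ, S0_eq_separated hσ hν hμ hsum]
  simp only [separated, plusC_add, plusC_mul, minusC_add, minusC_mul]
  refine ext_components ?_ ?_
  · rw [segal_add hσ (h₁.const_mul _) (k₁.const_mul _), segal_const_mul, segal_const_mul]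
    simp only [plusC_add, plusC_mul, plusC_pair]
    ring
  · rw [segal_add hσ (h₂.const_mul _) (k₂.const_mul _), segal_const_mul, segal_const_mul]
    simp only [minusC_add, minusC_mul, minusC_pair]
    ring

theorem S0_congr_ae {φ ψ : ℝ → Bicomplex} (h : φ =ᵐ[volume] ψ) : S0 σ ν μ φ = S0 σ ν μ ψ := by
  funext Z
  rw [S0, S0, fwTransform, fwTransform]
  congr 2
  refine integral_congr_ae ?_
  filter_upwards [h] with t ht
  rw [fwIntegrand, fwIntegrand, ht]

theorem S0_mem_M0 (hσ : 0 < σ) (hν : ν ^ 2 = -1) (hμ : μ ^ 2 = -1)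
    {φ : ℝ → Bicomplex} (hφ : MemLp φ 2) : S0 σ ν μ φ ∈ M0 σ ν μ := by
  obtain ⟨h₁, h₂⟩ := memLp_iff_components.1 hφ
  exact (mem_M0_iff hν hμ).2 ⟨_, _, (differentiable_segal hσ h₁).const_mul _,
    (differentiable_segal hσ h₂).const_mul _, memLp_s0Const_mul_segal hσ h₁,
    memLp_s0Const_mul_segal hσ h₂, S0_eq_separated hσ hν hμ hφ⟩

theorem exists_S0_eq (hσ : 0 < σ) (hν : ν ^ 2 = -1) (hμ : μ ^ 2 = -1)
    {U : Bicomplex → Bicomplex} (hU : U ∈ M0 σ ν μ) :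
    ∃ φ : ℝ → Bicomplex, MemLp φ 2 volume ∧ S0 σ ν μ φ = U := by
  obtain ⟨F, G, hF, hG, hF2, hG2, rfl⟩ := (mem_M0_iff hν hμ).1 hU
  obtain ⟨φ, hφ, rfl⟩ := exists_segal_eq hσ hF hF2
  obtain ⟨ψ, hψ, rfl⟩ := exists_segal_eq hσ hG hG2
  have hc : (s0Const σ : ℂ) ≠ 0 := Complex.ofReal_ne_zero.2 (s0Const_pos hσ).ne'
  have hm : MemLp (fun t => pair ((s0Const σ : ℂ)⁻¹ * φ t) ((s0Const σ : ℂ)⁻¹ * ψ t)) 2 := by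
    refine memLp_iff_components.2 ?_
    simp only [plusC_pair, minusC_pair]
    exact ⟨hφ.const_mul _, hψ.const_mul _⟩
  refine ⟨_, hm, ?_⟩
  rw [S0_eq_separated hσ hν hμ hm]
  simp only [plusC_pair, minusC_pair, segal_const_mul, mul_inv_cancel_left₀ hc]

theorem memLp_of_mem_M0 (hσ : 0 < σ) (hν : ν ^ 2 = -1) (hμ : μ ^ 2 = -1)
    {U : Bicomplex → Bicomplex} (hU : U ∈ M0 σ ν μ) : MemLp U 2 bcMeasure := by
  obtain ⟨F, G, hF, hG, hF2, hG2, rfl⟩ := (mem_M0_iff hν hμ).1 hU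
  exact memLp_separated hσ hν hμ (hF.continuous.mul (continuous_gauss_ofReal σ))
    (hG.continuous.mul (continuous_gauss_ofReal σ)) hF2 hG2

/-- The set is the range of the isometry induced by `S₀` on the complete space `L²(ℝ)`. -/
theorem isClosed_M0 (hσ : 0 < σ) (hν : ν ^ 2 = -1) (hμ : μ ^ 2 = -1) :
    IsClosed {u : Lp Bicomplex 2 bcMeasure | ∃ U ∈ M0 σ ν μ, u =ᵐ[bcMeasure] U} := by
  have hmem : ∀ φ : Lp Bicomplex 2 (volume : Measure ℝ), MemLp (S0 σ ν μ φ) 2 bcMeasure :=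
    fun φ => memLp_of_mem_M0 hσ hν hμ (S0_mem_M0 hσ hν hμ (Lp.memLp φ))
  set J : Lp Bicomplex 2 (volume : Measure ℝ) → Lp Bicomplex 2 bcMeasure :=
    fun φ => (hmem φ).toLp _ with hJ
  have hiso : Isometry J := fun φ ψ => by
    have hsub : S0 σ ν μ ⇑(φ - ψ) = S0 σ ν μ φ - S0 σ ν μ ψ := by
      have h1 : ⇑(φ - ψ) =ᵐ[volume] fun t => 1 * φ t + (-1) * ψ t := by
        filter_upwards [Lp.coeFn_sub φ ψ] with t ht
        rw [ht, Pi.sub_apply]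
        ring
      funext Z
      rw [S0_congr_ae h1, S0_linear hσ hν hμ (Lp.memLp φ) (Lp.memLp ψ), Pi.sub_apply]
      ring
    rw [edist_eq_enorm_sub, edist_eq_enorm_sub, hJ, ← MemLp.toLp_sub, Lp.enorm_toLp, ← hsub,
      eLpNorm_S0 hσ hν hμ (Lp.memLp _), Lp.enorm_def]
  convert hiso.isClosedEmbedding.isClosed_range
  refine Set.ext fun u => ⟨?_, ?_⟩
  · rintro ⟨U, hU, hu⟩
    obtain ⟨φ, hφ, rfl⟩ := exists_S0_eq hσ hν hμ hU
    refine ⟨hφ.toLp φ, Lp.ext ((MemLp.coeFn_toLp _).trans ?_)⟩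
    rw [S0_congr_ae hφ.coeFn_toLp]
    exact hu.symm
  · rintro ⟨φ, rfl⟩
    exact ⟨_, S0_mem_M0 hσ hν hμ (Lp.memLp φ), MemLp.coeFn_toLp _⟩

/-! ### The orthogonal basis -/

/-- The normalizing factor of the `n`-th basis function. -/
noncomputable def basisConst (σ : ℝ) (n : ℕ) : ℝ := (σ / Real.pi) ^ (3 / 4 : ℝ) * σ ^ n

theorem basisConst_pos (hσ : 0 < σ) (n : ℕ) : 0 < basisConst σ n := by
  unfold basisConst; positivity

theorem basisFun_eq_separated (σ : ℝ) (ν μ : Bicomplex) (n : ℕ) :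
    basisFun σ ν μ n = separated σ ν μ (fun z => basisConst σ n * (z ^ n * gauss σ z))
      fun z => basisConst σ n * (z ^ n * gauss σ z) := by
  funext Z
  refine ext_components ?_ ?_
  · rw [basisFun, plusC_mul, plusC_mul, plusC_ofR, plusC_ofR, ofReal_exp_norm_companion, plusC_pow,
      plusC_companion, separated, plusC_pair, coords, basisConst]
    ring
  · rw [basisFun, minusC_mul, minusC_mul, minusC_ofR, minusC_ofR, ofReal_exp_norm_companion,
      minusC_pow, minusC_companion, separated, minusC_pair, coords, basisConst]
    ring

theorem continuous_pow_mul_gauss (σ : ℝ) (c : ℂ) (n : ℕ) :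
    Continuous fun z : ℂ => c * (z ^ n * gauss σ z) :=
  continuous_const.mul ((continuous_pow n).mul (continuous_gauss_ofReal σ))

theorem basisFun_mem_M0 (hσ : 0 < σ) (hν : ν ^ 2 = -1) (hμ : μ ^ 2 = -1) (n : ℕ) :
    basisFun σ ν μ n ∈ M0 σ ν μ := by
  have hm : MemLp (fun z : ℂ => basisConst σ n * z ^ n * gauss σ z) 2 := by
    simp_rw [mul_assoc]
    exact (memLp_pow_mul_gauss hσ n).const_mul _
  refine (mem_M0_iff hν hμ).2 ⟨fun z => basisConst σ n * z ^ n, fun z => basisConst σ n * z ^ n,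
    by fun_prop, by fun_prop, hm, hm, ?_⟩
  rw [basisFun_eq_separated]
  simp only [mul_assoc]

theorem bcInner_basisFun_of_ne (hσ : 0 < σ) (hν : ν ^ 2 = -1) (hμ : μ ^ 2 = -1) {m n : ℕ}
    (h : m ≠ n) : bcInner bcMeasure (basisFun σ ν μ m) (basisFun σ ν μ n) = 0 := by
  have hc := fun n => continuous_pow_mul_gauss σ (basisConst σ n) n
  have hm : ∀ n : ℕ, MemLp (fun z : ℂ => basisConst σ n * (z ^ n * gauss σ z)) 2 :=
    fun n => (memLp_pow_mul_gauss hσ n).const_mul _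
  have h0 : ∫ z : ℂ, basisConst σ m * (z ^ m * gauss σ z) *
      conj (basisConst σ n * (z ^ n * gauss σ z)) = 0 := by
    have : ∀ z : ℂ, basisConst σ m * (z ^ m * gauss σ z) *
        conj (basisConst σ n * (z ^ n * gauss σ z)) = (basisConst σ m * basisConst σ n : ℂ) *
          (z ^ m * conj (z ^ n) * (gauss σ z : ℂ) ^ 2) := fun z => by
      simp only [map_mul, Complex.conj_ofReal]
      ring
    simp_rw [this]
    rw [integral_const_mul, integral_pow_mul_conj_pow_of_ne hσ h.symm, mul_zero]
  rw [basisFun_eq_separated, basisFun_eq_separated, bcInner_separated hσ hν hμ (hc m) (hc m) (hm m)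
    (hm m) (hc n) (hc n) (hm n) (hm n), h0, mul_zero]
  exact ext_components (by rw [plusC_pair, plusC_zero]) (by rw [minusC_pair, minusC_zero])

theorem eLpNorm_pow_mul_gauss_sq (hσ : 0 < σ) (n : ℕ) :
    eLpNorm (fun z : ℂ => z ^ n * gauss σ z) 2 volume ^ 2 =
      ENNReal.ofReal (2 * Real.pi / σ * ((2 / σ) ^ n * n.factorial)) := by
  have h := inner_monomialLp_self hσ n
  rw [inner_self_eq_norm_sq_to_K] at h
  have h' : ‖monomialLp hσ n‖ ^ 2 = 2 * Real.pi / σ * ((2 / σ) ^ n * n.factorial) := by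
    refine Complex.ofReal_injective (Eq.trans ?_ h)
    rw [Complex.ofReal_pow]
    rfl
  rw [← h', ENNReal.ofReal_pow (norm_nonneg _), ofReal_norm, monomialLp, Lp.enorm_toLp]

/-- Two equal components give `2 · π/(4σ) · (σ/π)^{3/2} σ^{2n} · (2π/σ)(2/σ)^n n!`. -/
theorem eLpNorm_basisFun_sq (hσ : 0 < σ) (hν : ν ^ 2 = -1) (hμ : μ ^ 2 = -1) (n : ℕ) :
    eLpNorm (basisFun σ ν μ n) 2 bcMeasure ^ 2 =
      ENNReal.ofReal ((Real.pi / σ) ^ (1 / 2 : ℝ) * 2 ^ n * σ ^ n * (n.factorial : ℝ)) := by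
  have hc := continuous_pow_mul_gauss σ (basisConst σ n) n
  have hr : 0 < Real.pi / σ := by positivity
  have hconst : ((σ / Real.pi) ^ (3 / 4 : ℝ)) ^ 2 * (Real.pi / σ) ^ 2 =
      (Real.pi / σ) ^ (1 / 2 : ℝ) := by
    rw [← inv_div, Real.inv_rpow hr.le, ← Real.rpow_neg hr.le, ← Real.rpow_natCast,
      ← Real.rpow_mul hr.le, ← Real.rpow_natCast, ← Real.rpow_add hr]
    norm_num
  rw [basisFun_eq_separated, eLpNorm_separated_sq hσ hν hμ hc hc, eLpNorm_const_mul_sq,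
    eLpNorm_pow_mul_gauss_sq hσ, ← ENNReal.ofReal_mul (by positivity),
    ← ENNReal.ofReal_add (by positivity) (by positivity), ← ENNReal.ofReal_mul (by positivity),
    ← hconst, basisConst, div_pow 2 σ n]
  congr 1
  field_simp
  ring

theorem tendsto_sq_zero_iff {f : ℕ → ℝ≥0∞} :
    Tendsto (fun N => f N ^ 2) atTop (𝓝 0) ↔ Tendsto f atTop (𝓝 0) := by
  refine ⟨fun h => ?_, fun h => ?_⟩
  · have := (ENNReal.continuous_rpow_const (y := 1 / 2)).tendsto 0 |>.comp h
    rw [ENNReal.zero_rpow_of_pos (by norm_num)] at this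
    refine this.congr fun N => ?_
    rw [Function.comp_apply, ← ENNReal.rpow_natCast, ← ENNReal.rpow_mul]
    norm_num
  · have := ((ENNReal.continuous_pow 2).tendsto 0).comp h
    rwa [zero_pow two_ne_zero] at this

/-- The squared norm is a positive finite constant times a sum of two nonnegative terms, so it tends
to zero exactly when both terms do. -/
theorem tendsto_eLpNorm_separated_iff (hσ : 0 < σ) (hν : ν ^ 2 = -1) (hμ : μ ^ 2 = -1)
    {u v : ℕ → ℂ → ℂ} (hu : ∀ N, Continuous (u N)) (hv : ∀ N, Continuous (v N)) :
    Tendsto (fun N => eLpNorm (separated σ ν μ (u N) (v N)) 2 bcMeasure) atTop (𝓝 0) ↔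
      Tendsto (fun N => eLpNorm (u N) 2 volume) atTop (𝓝 0) ∧
        Tendsto (fun N => eLpNorm (v N) 2 volume) atTop (𝓝 0) := by
  rw [← tendsto_sq_zero_iff, ← tendsto_sq_zero_iff (f := fun N => eLpNorm (u N) 2 volume),
    ← tendsto_sq_zero_iff (f := fun N => eLpNorm (v N) 2 volume)]
  simp_rw [eLpNorm_separated_sq hσ hν hμ (hu _) (hv _)]
  set C := ENNReal.ofReal (Real.pi / (4 * σ)) with hC
  have hC0 : C ≠ 0 := by
    rw [hC, Ne, ENNReal.ofReal_eq_zero, not_le]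
    positivity
  have hCt : C ≠ ∞ := ENNReal.ofReal_ne_top
  refine ⟨fun h => ?_, fun h => ?_⟩
  · have h' := ENNReal.Tendsto.const_mul h (Or.inr (ENNReal.inv_ne_top.2 hC0))
    simp only [mul_zero, ENNReal.inv_mul_cancel_left' (fun h => absurd h hC0)
      (fun h => absurd h hCt)] at h'
    exact ⟨tendsto_of_tendsto_of_tendsto_of_le_of_le tendsto_const_nhds h' (fun _ => zero_le)
        fun _ => le_self_add,
      tendsto_of_tendsto_of_tendsto_of_le_of_le tendsto_const_nhds h' (fun _ => zero_le)
        fun _ => le_add_self⟩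
  · have h' := ENNReal.Tendsto.const_mul (h.1.add h.2) (Or.inr hCt)
    simpa using h'

/-- A bicomplex coefficient is a pair of complex ones, so the expansion amounts to the monomial
expansions of `F` and `G`, with coefficients rescaled by the nonzero `basisConst`. Uniqueness holds
in each component. -/
theorem existsUnique_basisFun_expansion (hσ : 0 < σ) (hν : ν ^ 2 = -1) (hμ : μ ^ 2 = -1)
    {U : Bicomplex → Bicomplex} (hU : U ∈ M0 σ ν μ) :
    ∃! c : ℕ → Bicomplex, Tendsto (fun N : ℕ => eLpNorm
      (fun Z => U Z - ∑ k ∈ Finset.range N, c k * basisFun σ ν μ k Z) 2 bcMeasure)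
      atTop (𝓝 0) := by
  obtain ⟨F, G, hF, hG, hF2, hG2, rfl⟩ := (mem_M0_iff hν hμ).1 hU
  have hsep : ∀ (c : ℕ → Bicomplex) (N : ℕ), (fun Z => separated σ ν μ (fun z => F z * gauss σ z)
      (fun z => G z * gauss σ z) Z - ∑ k ∈ Finset.range N, c k * basisFun σ ν μ k Z) =
      separated σ ν μ
        (fun z => F z * gauss σ z - ∑ k ∈ Finset.range N,
          (plusC (c k) * basisConst σ k) * (z ^ k * gauss σ z))
        (fun z => G z * gauss σ z - ∑ k ∈ Finset.range N,
          (minusC (c k) * basisConst σ k) * (z ^ k * gauss σ z)) := fun c N => by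
    funext Z
    simp_rw [basisFun_eq_separated]
    refine ext_components ?_ ?_
    · simp only [separated, plusC_sub, plusC_sum, plusC_mul, plusC_pair, sub_mul, Finset.sum_mul,
        mul_assoc]
    · simp only [separated, minusC_sub, minusC_sum, minusC_mul, minusC_pair, sub_mul,
        Finset.sum_mul, mul_assoc]
  have hcont : ∀ {f : ℂ → ℂ}, Differentiable ℂ f → ∀ (a : ℕ → ℂ) (N : ℕ),
      Continuous fun z => f z * gauss σ z - ∑ k ∈ Finset.range N, a k * (z ^ k * gauss σ z) :=
    fun hf a N => (hf.continuous.mul (continuous_gauss_ofReal σ)).sub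
      (continuous_finsetSum _ fun k _ => continuous_pow_mul_gauss σ (a k) k)
  simp_rw [hsep, tendsto_eLpNorm_separated_iff hσ hν hμ (hcont hF _) (hcont hG _)]
  have hne : ∀ k, (basisConst σ k : ℂ) ≠ 0 := fun k =>
    Complex.ofReal_ne_zero.2 (basisConst_pos hσ k).ne'
  obtain ⟨a, ha, ha'⟩ := existsUnique_monomial_expansion hσ hF hF2
  obtain ⟨b, hb, hb'⟩ := existsUnique_monomial_expansion hσ hG hG2
  refine ⟨fun k => pair (a k / basisConst σ k) (b k / basisConst σ k), ?_, fun c hc => ?_⟩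
  · simp only [plusC_pair, minusC_pair, div_mul_cancel₀ _ (hne _)]
    exact ⟨ha, hb⟩
  · have h1 := ha' _ hc.1
    have h2 := hb' _ hc.2
    funext k
    refine ext_components ?_ ?_
    · rw [plusC_pair, eq_div_iff (hne k)]
      exact congrFun h1 k
    · rw [minusC_pair, eq_div_iff (hne k)]
      exact congrFun h2 k

end BicomplexFW

theorem mainTheorem2 (σ : ℝ) (hσ : 0 < σ) (ν μ : BicomplexFW.Bicomplex)
    (hν : ν ^ 2 = -1) (hμ : μ ^ 2 = -1) :
    -- `M₀` is a Hilbert subspace of `L²(λ)`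
    (∀ U ∈ BicomplexFW.M0 σ ν μ, MemLp U 2 BicomplexFW.bcMeasure) ∧
    IsClosed {u : Lp BicomplexFW.Bicomplex 2 BicomplexFW.bcMeasure |
      ∃ U ∈ BicomplexFW.M0 σ ν μ, u =ᵐ[BicomplexFW.bcMeasure] U} ∧
    -- the integral that defines `S₀ φ` converges
    (∀ φ : ℝ → BicomplexFW.Bicomplex, MemLp φ 2 volume → ∀ Z,
      Integrable (BicomplexFW.fwIntegrand σ ν μ φ (BicomplexFW.gaussWindow σ) Z)) ∧
    -- `S₀` is linear over the bicomplex numbers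
    (∀ φ₁ φ₂ : ℝ → BicomplexFW.Bicomplex, MemLp φ₁ 2 volume → MemLp φ₂ 2 volume →
      ∀ c₁ c₂ : BicomplexFW.Bicomplex, ∀ Z,
        BicomplexFW.S0 σ ν μ (fun t => c₁ * φ₁ t + c₂ * φ₂ t) Z =
          c₁ * BicomplexFW.S0 σ ν μ φ₁ Z + c₂ * BicomplexFW.S0 σ ν μ φ₂ Z) ∧
    -- `S₀` maps `L²(ℝ)` onto `M₀`
    (∀ φ : ℝ → BicomplexFW.Bicomplex, MemLp φ 2 volume →
      BicomplexFW.S0 σ ν μ φ ∈ BicomplexFW.M0 σ ν μ) ∧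
    (∀ U ∈ BicomplexFW.M0 σ ν μ, ∃ φ : ℝ → BicomplexFW.Bicomplex,
      MemLp φ 2 volume ∧ BicomplexFW.S0 σ ν μ φ = U) ∧
    -- `S₀` preserves norms and bicomplex scalar products
    (∀ φ : ℝ → BicomplexFW.Bicomplex, MemLp φ 2 volume →
      eLpNorm (BicomplexFW.S0 σ ν μ φ) 2 BicomplexFW.bcMeasure = eLpNorm φ 2 volume) ∧
    (∀ φ₁ φ₂ : ℝ → BicomplexFW.Bicomplex, MemLp φ₁ 2 volume → MemLp φ₂ 2 volume →
      BicomplexFW.bcInner BicomplexFW.bcMeasure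
          (BicomplexFW.S0 σ ν μ φ₁) (BicomplexFW.S0 σ ν μ φ₂) =
        BicomplexFW.bcInner volume φ₁ φ₂) ∧
    -- the functions `φ_n` form an orthogonal basis of `M₀`
    (∀ n : ℕ, BicomplexFW.basisFun σ ν μ n ∈ BicomplexFW.M0 σ ν μ) ∧
    (∀ m n : ℕ, m ≠ n →
      BicomplexFW.bcInner BicomplexFW.bcMeasure
        (BicomplexFW.basisFun σ ν μ m) (BicomplexFW.basisFun σ ν μ n) = 0) ∧
    (∀ U ∈ BicomplexFW.M0 σ ν μ, ∃! c : ℕ → BicomplexFW.Bicomplex,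
      Tendsto (fun N : ℕ => eLpNorm
          (fun Z => U Z - ∑ k ∈ Finset.range N, c k * BicomplexFW.basisFun σ ν μ k Z)
          2 BicomplexFW.bcMeasure) atTop (𝓝 0)) ∧
    -- the norms of the `φ_n`
    (∀ n : ℕ, eLpNorm (BicomplexFW.basisFun σ ν μ n) 2 BicomplexFW.bcMeasure ^ 2 =
      ENNReal.ofReal ((Real.pi / σ) ^ (1 / 2 : ℝ) * 2 ^ n * σ ^ n * (n.factorial : ℝ))) := by
  open BicomplexFW in
  exact ⟨fun U hU => memLp_of_mem_M0 hσ hν hμ hU, isClosed_M0 hσ hν hμ,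
    fun φ hφ Z => integrable_fwIntegrand hσ hν hμ hφ Z,
    fun φ₁ φ₂ h₁ h₂ c₁ c₂ Z => S0_linear hσ hν hμ h₁ h₂ c₁ c₂ Z,
    fun φ hφ => S0_mem_M0 hσ hν hμ hφ, fun U hU => exists_S0_eq hσ hν hμ hU,
    fun φ hφ => eLpNorm_S0 hσ hν hμ hφ, fun φ₁ φ₂ h₁ h₂ => bcInner_S0 hσ hν hμ h₁ h₂,
    basisFun_mem_M0 hσ hν hμ, fun m n h => bcInner_basisFun_of_ne hσ hν hμ h,
    fun U hU => existsUnique_basisFun_expansion hσ hν hμ hU, eLpNorm_basisFun_sq hσ hν hμ⟩
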